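/- \textbf{Conventions.} Terms are built from a ranked signature $\mathcal F$ and an infinite set of variables; a distinguished set of binary symbols is declared AC, and $\mathsf{AC}$ denotes the associativity and commutativity equations of these symbols, $\sim$ the congruence $\leftrightarrow^*_{\mathsf{AC}}$, and $\mathsf{AC}^{\pm}$ the set $\mathsf{AC}$ together with its reversed equations. An ES is a set of pairs of terms (equations); a TRS is a set of rules $\ell\to r$ with $\ell$ not a variable and $\mathrm{Var}(r)\subseteq\mathrm{Var}(\ell)$. Put ${\to_{\mathcal R/\mathsf{AC}}}={\sim}\cdot{\to_{\mathcal R}}\cdot{\sim}$, and let $s\to_{\mathcal R,\mathsf{AC}}t$ mean $s|_p\sim\ell\sigma$ and $t=s[r\sigma]_p$ for some $\ell\to r\in\mathcal R$, position $p$ and substitution $\sigma$. A TRS $\mathcal R$ is \emph{AC-canonical} if $\to_{\mathcal R/\mathsf{AC}}$ is terminating, $({\leftarrow_{\mathcal R}}\cup{\to_{\mathcal R}}\cup{\sim})^*\subseteq{\to^*_{\mathcal R}}\cdot{\sim}\cdot{\leftarrow^*_{\mathcal R}}$, every left-hand side $\ell$ of a rule $\ell\to r\in\mathcal R$ is a normal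 form of $\to_{\mathcal R\setminus\{\ell\to r\}}$, and every right-hand side is a normal form of $\to_{\mathcal R/\mathsf{AC}}$. It is a \emph{presentation} of an ES $\mathcal E$ (modulo AC) if ${\leftrightarrow^*_{\mathcal E\cup\mathsf{AC}}}={\leftrightarrow^*_{\mathcal R\cup\mathsf{AC}}}$. $\mathrm{CP}(\mathcal R_1,\mathcal R_2)$ denotes the set of critical pairs $\ell_2\sigma[r_1\sigma]_p\approx r_2\sigma$, where $\ell_1\to r_1$ and $\ell_2\to r_2$ are variants, without common variables, of elements of $\mathcal R_1$ and $\mathcal R_2$, $p$ is a non-variable position of $\ell_2$, $\sigma$ is a most general unifier of $\ell_1$ and $\ell_2|_p$, and the two are not variants of each other if $p=\epsilon$. The critical pair is prime with respect to a TRS $\mathcal S$ if all proper subterms of $\ell_1\sigma$ are $\to_{\mathcal S}$-normal forms. \textbf{The completion procedure of \textsf{accompll}.} The tool is given a finite ES $\mathcal E$, a termination tool that answers YES only for TRSs $\mathcal C$ such that $\to_{\mathcal C/\mathsf{AC}}$ is terminating, and two options: a relation $\rightharpoonup_{\mathcal S}$ among $\to_{\mathcal S}$, $\to_{\mathcal S,\mathsf{AC}}$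 and $\to_{\mathcal S/\mathsf{AC}}$, and whether only prime critical pairs are computed. One thread prefers to orient equations from left to right, the other from right to left; the tool outputs the result of a thread that succeeds. A thread works on quadruples $(\mathcal E,\mathcal P,\mathcal R,\mathcal C)$ of equations, pending rules, rules and constraints. It starts with $(\mathcal E,\varnothing,\varnothing,\varnothing)$ and repeats the following steps. \begin{enumerate} \item (simplify, delete) Rewrite both sides of every equation to normal form with respect to $\rightharpoonup_{\mathcal P\cup\mathcal R}$; then remove all equations $s\approx t$ with $s\sim t$. \item If $\mathcal E\cup\mathcal P=\varnothing$, succeed and output $\mathcal R$. \item (choose, orient) A rule is acceptable if its left-hand side is linear and the termination tool answers YES for the union of $\mathcal C$ and this rule. Choose an element of minimal size (sum of the sizes of both sides) among the pending rules and the equations that give an acceptable rule in at least one direction; if there is none, fail. Remove it from $\mathcal P$ or $\mathcal E$. If it is a pending rule, let $\rho$ be this rule. If it is an equation, let $\rho$ be the rule obtained by orienting it in the preferred direction if that is acceptable and in the other direction otherwise, and add $\rho$ to $\mathcal C$. \item (deduce) Add the critical pairs in $\mathrm{CP}(\{\rho\},\{\rho\})\cup\mathrm{CP}(\mathcal R,\{\rho\})\cup\mathrm{CP}(\{\rho\},\mathcal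 R)$ to $\mathcal E$. Add to $\mathcal P$ the rules $u\to t$ for $t\approx u$ in $\mathrm{CP}(\{\rho\},\mathsf{AC}^{\pm})$ and the rules $t\to u$ for $t\approx u$ in $\mathrm{CP}(\mathsf{AC}^{\pm},\{\rho\})$. Both are computed up to renaming of variables, and restricted to critical pairs that are prime with respect to $\mathcal R\cup\{\rho\}$ if this option is set. Add $\rho$ to $\mathcal R$. \item (compose) Replace the right-hand side of every rule in $\mathcal P\cup\mathcal R$ (in particular of $\rho$) by a normal form with respect to $\rightharpoonup_{\mathcal P\cup\mathcal R}$. \item (collapse) Every rule $\ell\to r\neq\rho$ of $\mathcal R$ with $\ell\to_{\{\rho\}}u$ for some $u$, and every pending rule $\ell\to r$ of $\mathcal P$ with $\ell\to_{\mathcal R}u$ for some $u$ (now $\rho\in\mathcal R$), is removed and the equation $u\approx r$ is added to $\mathcal E$, for one such $u$. \end{enumerate} \textbf{Theorem.} If the tool \textsf{accompll} outputs $\mathcal R$ on input of a finite ES $\mathcal E$, then $\mathcal R$ is a TRS which is an AC-canonical presentation of $\mathcal E$. -/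

import Mathlib

namespace LLAC

universe u v w

/-- A pair of terms over the signature `L` (the function symbols of `L` with their arities) and the
variables `V`, read as an equation `s ≈ t` or as a rule `s → t`. -/
abbrev TPair (L : FirstOrder.Language.{u, v}) (V : Type w) := L.Term V × L.Term V

section Terms

variable {L : FirstOrder.Language.{u, v}} {V : Type w}

/-- The set of variables of a term. -/
def vars : L.Term V → Set V
  | .var x => {x}
  | .func _ ts => ⋃ i, vars (ts i)

/-- No variable occurs more than once. -/
def Linear : L.Term V → Prop
  | .var _ => True
  | .func _ ts =>
      (∀ i, Linear (ts i)) ∧ ∀ i j, i ≠ j → Disjoint (vars (ts i)) (vars (ts j))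

/-- The size of a term: its number of symbol occurrences. -/
def size : L.Term V → ℕ
  | .var _ => 1
  | .func _ ts => 1 + ∑ i, size (ts i)

/-- `(ℓ, r)` qualifies as a rewrite rule: `ℓ` is not a variable and `Var(r) ⊆ Var(ℓ)`. -/
def IsRule (q : TPair L V) : Prop :=
  (∀ x, q.1 ≠ FirstOrder.Language.Term.var x) ∧ vars q.2 ⊆ vars q.1

/-- A term rewrite system is a set of rules. -/
def IsTRS (R : Set (TPair L V)) : Prop := ∀ q ∈ R, IsRule q

/-- `q'` arises from `q` by a (bijective) renaming of variables. -/
def Variant (q q' : TPair L V) : Prop :=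
  ∃ π : Equiv.Perm V, q' = (q.1.relabel π, q.2.relabel π)

/-- One-hole contexts. In `app f i ts C` the hole lies in the `i`-th argument of `f`, the other
arguments are given by `ts` (the value `ts i` is irrelevant). -/
inductive Ctx (L : FirstOrder.Language.{u, v}) (V : Type w) : Type (max u w)
  | hole : Ctx L V
  | app {n : ℕ} (f : L.Functions n) (i : Fin n) (ts : Fin n → L.Term V) (C : Ctx L V) : Ctx L V

/-- `C[t]`. -/
def Ctx.fill : Ctx L V → L.Term V → L.Term V
  | .hole, t => t
  | .app f i ts C, t => .func f (Function.update ts i (C.fill t))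

/-- `Cσ`. -/
def Ctx.subst : Ctx L V → (V → L.Term V) → Ctx L V
  | .hole, _ => .hole
  | .app f i ts C, σ => .app f i (fun j => (ts j).subst σ) (C.subst σ)

/-- `b` is a proper subterm of `a`. -/
def ProperSubterm (b a : L.Term V) : Prop := ∃ C : Ctx L V, C ≠ .hole ∧ a = C.fill b

/-- `σ` is a most general unifier of `s` and `t`. -/
def IsMGU (σ : V → L.Term V) (s t : L.Term V) : Prop :=
  s.subst σ = t.subst σ ∧
    ∀ τ : V → L.Term V, s.subst τ = t.subst τ → ∃ δ : V → L.Term V, ∀ x, τ x = (σ x).subst δ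

end Terms

section Rewriting

variable {L : FirstOrder.Language.{u, v}} {V : Type w}

/-- The rewrite relation `→_E` of a set of pairs of terms. -/
def Step (E : Set (TPair L V)) (s t : L.Term V) : Prop :=
  ∃ q ∈ E, ∃ (C : Ctx L V) (σ : V → L.Term V),
    s = C.fill (q.1.subst σ) ∧ t = C.fill (q.2.subst σ)

/-- `t` is a normal form of `→_R`. -/
def NF (R : Set (TPair L V)) (t : L.Term V) : Prop := ∀ u, ¬ Step R t u

/-- The conversion `↔*_E`, that is, the equational theory of `E`. -/
def Conv (E : Set (TPair L V)) : L.Term V → L.Term V → Prop := Relation.EqvGen (Step E)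

/-- Rewriting modulo `B`: `→_{R/B} = ∼_B · →_R · ∼_B`, where `∼_B` is `↔*_B`. -/
def StepMod (B R : Set (TPair L V)) (s t : L.Term V) : Prop :=
  ∃ s' t', Conv B s s' ∧ Step R s' t' ∧ Conv B t' t

/-- Peterson–Stickel rewriting `→_{R,B}`: rewriting with matching modulo `B`. -/
def StepPS (B R : Set (TPair L V)) (s t : L.Term V) : Prop :=
  ∃ q ∈ R, ∃ (C : Ctx L V) (σ : V → L.Term V) (a : L.Term V),
    s = C.fill a ∧ Conv B a (q.1.subst σ) ∧ t = C.fill (q.2.subst σ)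

/-- `R` is terminating modulo `B`. -/
def TerminatingMod (B R : Set (TPair L V)) : Prop :=
  ¬ ∃ f : ℕ → L.Term V, ∀ n, StepMod B R (f n) (f (n + 1))

/-- `R` is Church–Rosser modulo `B`: every conversion in `←_R ∪ →_R ∪ ∼_B` is contained in
`→_R* · ∼_B · ←_R*`. -/
def ChurchRosserMod (B R : Set (TPair L V)) : Prop :=
  ∀ s t, Relation.EqvGen (fun a b => Step R a b ∨ Conv B a b) s t →
    ∃ s' t', Relation.ReflTransGen (Step R) s s' ∧ Conv B s' t' ∧
      Relation.ReflTransGen (Step R) t t'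

/-- `R` is complete modulo `B`. -/
def CompleteMod (B R : Set (TPair L V)) : Prop := TerminatingMod B R ∧ ChurchRosserMod B R

/-- Every left-hand side is a normal form of the other rules. -/
def LeftReduced (R : Set (TPair L V)) : Prop := ∀ q ∈ R, NF (R \ {q}) q.1

/-- Every right-hand side is a normal form of `→_{R/B}`. -/
def RightReducedMod (B R : Set (TPair L V)) : Prop := ∀ q ∈ R, ∀ u, ¬ StepMod B R q.2 u

/-- `R` is canonical modulo `B`. -/
def CanonicalMod (B R : Set (TPair L V)) : Prop :=
  CompleteMod B R ∧ LeftReduced R ∧ RightReducedMod B R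

/-- `R` is a presentation of `E` modulo `B`: `↔*_{E ∪ B} = ↔*_{R ∪ B}`. -/
def PresentsMod (B R E : Set (TPair L V)) : Prop := ∀ s t, Conv (E ∪ B) s t ↔ Conv (R ∪ B) s t

/-- The commutativity and associativity axioms of the symbols in `ac` (with all choices of
distinct variables). -/
def AC (V : Type w) (ac : Set (L.Functions 2)) : Set (TPair L V) :=
  {e | ∃ f ∈ ac, ∃ x y : V, x ≠ y ∧ e = (f.apply₂ (.var x) (.var y), f.apply₂ (.var y) (.var x))} ∪
  {e | ∃ f ∈ ac, ∃ x y z : V, x ≠ y ∧ y ≠ z ∧ x ≠ z ∧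
    e = (f.apply₂ (f.apply₂ (.var x) (.var y)) (.var z),
         f.apply₂ (.var x) (f.apply₂ (.var y) (.var z)))}

/-- `E^±`: the symmetric closure of `E`. -/
def symm (E : Set (TPair L V)) : Set (TPair L V) := E ∪ Prod.swap '' E

/-- There is a critical peak `t ←[p] s →[ε] u` obtained from an overlap `⟨ρ₁, p, ρ₂⟩` of (variants
of) `ρ₁ ∈ R₁` and `ρ₂ ∈ R₂`, where `a = s|_p`. The position `p` in the left-hand side of `ρ₂` is
given by the context `C` around it. -/
def CritPeak (R₁ R₂ : Set (TPair L V)) (t a s u : L.Term V) : Prop :=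
  ∃ ρ₁ ρ₂ : TPair L V, (∃ q ∈ R₁, Variant q ρ₁) ∧ (∃ q ∈ R₂, Variant q ρ₂) ∧
    Disjoint (vars ρ₁.1 ∪ vars ρ₁.2) (vars ρ₂.1 ∪ vars ρ₂.2) ∧
    ∃ (C : Ctx L V) (b : L.Term V) (σ : V → L.Term V),
      ρ₂.1 = C.fill b ∧ (∀ x, b ≠ FirstOrder.Language.Term.var x) ∧ IsMGU σ ρ₁.1 b ∧
      (C = .hole → ¬ Variant ρ₁ ρ₂) ∧
      a = ρ₁.1.subst σ ∧ s = ρ₂.1.subst σ ∧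
      t = (C.subst σ).fill (ρ₁.2.subst σ) ∧ u = ρ₂.2.subst σ

/-- The critical pairs `CP(R₁, R₂)`; if `prime` is set, only those whose critical peak is prime,
irreducibility of the proper subterms of `s|_p` being checked with respect to `R`. -/
def critPairs (prime : Bool) (R R₁ R₂ : Set (TPair L V)) : Set (TPair L V) :=
  {e | ∃ a s, CritPeak R₁ R₂ e.1 a s e.2 ∧ (prime = true → ∀ b, ProperSubterm b a → NF R b)}

/-- `D` is a finite list of representatives of `S` up to renaming of variables. -/
def Represents (D S : Set (TPair L V)) : Prop :=
  D.Finite ∧ D ⊆ S ∧ ∀ e ∈ S, ∃ d ∈ D, Variant d e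

end Rewriting

section Tool

variable {L : FirstOrder.Language.{u, v}} {V : Type w}

/-- The rewrite relation used for the inference rules simplify and compose. -/
inductive RewriteMode
  /-- `→_R` -/
  | plain
  /-- `→_{R,AC}` -/
  | matchingAC
  /-- `→_{R/AC}` -/
  | moduloAC

/-- User-supplied options of the tool. -/
structure Options where
  /-- the relation used for simplify and compose -/
  mode : RewriteMode
  /-- restrict the computation of critical pairs to prime ones -/
  prime : Bool

/-- The relation selected by the options, for the rule set `R`. -/
def Options.rew (o : Options) (ac : Set (L.Functions 2)) (R : Set (TPair L V)) :
    L.Term V → L.Term V → Prop :=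
  match o.mode with
  | .plain => Step R
  | .matchingAC => StepPS (AC V ac) R
  | .moduloAC => StepMod (AC V ac) R

/-- `g` computes a normal form of every term with respect to `r`. -/
def IsNormalizer (r : L.Term V → L.Term V → Prop) (g : L.Term V → L.Term V) : Prop :=
  ∀ t, Relation.ReflTransGen r t (g t) ∧ ∀ u, ¬ r (g t) u

/-- A state of the main loop: equations, pending rules, rules, and the constraint system. -/
structure State (L : FirstOrder.Language.{u, v}) (V : Type w) where
  E : Set (TPair L V)
  P : Set (TPair L V)
  R : Set (TPair L V)
  C : Set (TPair L V)

/-- Simplify followed by delete: both sides of all equations are rewritten to normal form with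
respect to `P ∪ R`, then all equations between AC equivalent terms are removed. -/
def SimplifyDelete (o : Options) (ac : Set (L.Functions 2)) (S S' : State L V) : Prop :=
  ∃ g, IsNormalizer (o.rew ac (S.P ∪ S.R)) g ∧
    S' = { S with E := {e | (∃ d ∈ S.E, e = (g d.1, g d.2)) ∧ ¬ Conv (AC V ac) e.1 e.2} }

/-- `q` is accepted as a new rule: it has a linear left-hand side and the termination tool answers
YES for the constraint system extended by `q`. -/
def Acceptable (tt : Set (TPair L V) → Prop) (C : Set (TPair L V)) (q : TPair L V) : Prop :=
  IsRule q ∧ Linear q.1 ∧ tt (insert q C)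

/-- The equation `e` is oriented into the rule `q`: the preferred direction (left to right if `lr`
is true, right to left otherwise) is tried first, the other one only if this fails. -/
def Orients (tt : Set (TPair L V) → Prop) (lr : Bool) (C : Set (TPair L V)) (e q : TPair L V) :
    Prop :=
  let d := if lr then e else e.swap
  (Acceptable tt C d ∧ q = d) ∨ (¬ Acceptable tt C d ∧ Acceptable tt C d.swap ∧ q = d.swap)

/-- The measure `|s| + |t|`. -/
def pairSize (e : TPair L V) : ℕ := size e.1 + size e.2

/-- `e` is minimal in size among the pending rules and the orientable equations. -/
def Smallest (tt : Set (TPair L V) → Prop) (lr : Bool) (S : State L V) (e : TPair L V) : Prop :=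
  (∀ d ∈ S.P, pairSize e ≤ pairSize d) ∧
    ∀ d ∈ S.E, (∃ q, Orients tt lr S.C d q) → pairSize e ≤ pairSize d

/-- Choose and orient: the selected equation or pending rule is removed from its set, the resulting
rule `ρ` is returned (and added to the constraint system if it stems from an equation). Equations
that are orientable in neither direction are postponed. -/
inductive Select (tt : Set (TPair L V) → Prop) (lr : Bool) (S : State L V) :
    TPair L V → State L V → Prop
  | pending (ρ : TPair L V) : ρ ∈ S.P → Smallest tt lr S ρ →
      Select tt lr S ρ { S with P := S.P \ {ρ} }
  | equation (e ρ : TPair L V) : e ∈ S.E → Smallest tt lr S e → Orients tt lr S.C e ρ →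
      Select tt lr S ρ { S with E := S.E \ {e}, C := insert ρ S.C }

/-- Deduce: `ρ` becomes a rule; the new critical pairs `CP({ρ}) ∪ CP^±(R, {ρ})` are added as
equations and those in `CP^±(AC^±, {ρ})` as pending rules, oriented such that the side reached by
the step with `ρ` is the right-hand side. -/
def Deduce (o : Options) (ac : Set (L.Functions 2)) (ρ : TPair L V) (S S' : State L V) : Prop :=
  let R := insert ρ S.R
  let cp := critPairs (L := L) (V := V) o.prime R
  ∃ D K : Set (TPair L V),
    Represents D (cp {ρ} {ρ} ∪ (cp S.R {ρ} ∪ cp {ρ} S.R)) ∧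
    Represents K (Prod.swap '' cp {ρ} (symm (AC V ac)) ∪ cp (symm (AC V ac)) {ρ}) ∧
    S' = { E := S.E ∪ D, P := S.P ∪ K, R := R, C := S.C }

/-- Compose: the right-hand sides of all rules in `P ∪ R` are rewritten to normal form with
respect to `P ∪ R`. The rule `ρ` of `R` is thereby turned into `ρ'`. -/
def Compose (o : Options) (ac : Set (L.Functions 2)) (ρ : TPair L V) (S : State L V)
    (ρ' : TPair L V) (S' : State L V) : Prop :=
  ∃ g, IsNormalizer (o.rew ac (S.P ∪ S.R)) g ∧ ρ' = (ρ.1, g ρ.2) ∧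
    S' = { S with P := (fun q => (q.1, g q.2)) '' S.P, R := (fun q => (q.1, g q.2)) '' S.R }

/-- Collapse: every rule of `R` other than `ρ` whose left-hand side is reducible by `ρ`, and every
pending rule whose left-hand side is reducible by `R` (which contains `ρ`), is turned into an
equation by one rewrite step on its left-hand side. -/
def Collapse (ρ : TPair L V) (S S' : State L V) : Prop :=
  let RC := {q ∈ S.R | q ≠ ρ ∧ ¬ NF {ρ} q.1}
  let PC := {q ∈ S.P | ¬ NF S.R q.1}
  ∃ c d : TPair L V → L.Term V,
    (∀ q ∈ RC, Step {ρ} q.1 (c q)) ∧ (∀ q ∈ PC, Step S.R q.1 (d q)) ∧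
    S' = { E := S.E ∪ ((fun q => (c q, q.2)) '' RC ∪ (fun q => (d q, q.2)) '' PC)
           P := S.P \ PC
           R := S.R \ RC
           C := S.C }

/-- One iteration of the main loop of a thread:
simplify, delete, choose and orient, deduce, compose, collapse. -/
def Iteration (tt : Set (TPair L V) → Prop) (o : Options) (ac : Set (L.Functions 2)) (lr : Bool)
    (S S' : State L V) : Prop :=
  ∃ (S₁ S₂ S₃ S₄ : State L V) (ρ ρ' : TPair L V),
    SimplifyDelete o ac S S₁ ∧ Select tt lr S₁ ρ S₂ ∧ Deduce o ac ρ S₂ S₃ ∧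
      Compose o ac ρ S₃ ρ' S₄ ∧ Collapse ρ' S₄ S'

/-- The thread with orientation preference `lr` succeeds on input `E` with result `R`: after
finitely many iterations from `(E, ∅, ∅, ∅)`, simplify and delete leave neither equations nor
pending rules. -/
def ThreadOutputs (tt : Set (TPair L V) → Prop) (o : Options) (ac : Set (L.Functions 2))
    (lr : Bool) (E R : Set (TPair L V)) : Prop :=
  ∃ S S' : State L V,
    Relation.ReflTransGen (Iteration tt o ac lr) { E := E, P := ∅, R := ∅, C := ∅ } S ∧
      SimplifyDelete o ac S S' ∧ S'.E ∪ S'.P = ∅ ∧ R = S'.R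

/-- The tool `accompll` runs one thread for each orientation preference and outputs the result of a
thread that succeeds. -/
def AccompllOutputs (tt : Set (TPair L V) → Prop) (o : Options) (ac : Set (L.Functions 2))
    (E R : Set (TPair L V)) : Prop :=
  ∃ lr : Bool, ThreadOutputs tt o ac lr E R

/-- The termination tool is sound: it answers YES only for (finite) TRSs that are terminating
modulo AC. -/
def SoundTool (ac : Set (L.Functions 2)) (tt : Set (TPair L V) → Prop) : Prop :=
  ∀ C : Set (TPair L V), C.Finite → IsTRS C → tt C → TerminatingMod (AC V ac) C

end Tool

end LLAC

/-!
Every run of the completion procedure maintains an invariant from which the Church–Rosser property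
of the final system can be read off without proof orders on whole conversions.

Write `s > t` for `→⁺_{C/AC}`, where `C` is the final constraint system (`Gt`); it is well founded,
because `C` is empty or accepted by the termination tool, and all rules and pending rules that ever occur are
decreasing for it. Two terms are *connected below `s`* if they are joined by a conversion with the
current equations, rules and AC all of whose terms are smaller than `s` (`ConvIn (Gt B C s)`).

*Confluence criterion.* By well-founded induction, normal forms of AC-equivalent terms are
AC-equivalent as soon as the two ends of every local peak `t ← s → u` are connected below `s` and
every local cliff `t ← s ↔ u` has a step `u → w` with `t` and `w` connected below `s`
(`normalForms_equivalent`). By left-linearity, and because the AC axioms are linear and preserve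
variables, peaks and cliffs without an overlap always satisfy this. Overlaps with a reducible proper
subterm of the inner redex can be skipped: an innermost step is inserted between the two sides of
the peak or cliff (`peak_connected`, `cliff_connected`). So only *prime overlaps* matter
(`LocallyConnected`).

*Critical pairs.* All rules are left-linear and AC is linear, so that only linear terms without
common variables have to be unified. Such a unifier is assembled argument by argument
(`exists_isLinearUnifier`), which shows that every overlap is an instance of a critical peak
(`exists_critPeak`), and also that pending rules, whose left-hand sides are components of critical
pairs, are again left-linear (`IsMGU.linearOutside`, `pending_of_critPairs`).

*Invariance.* Connectedness of the prime overlaps of the current rules survives every step of an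
iteration (`LocallyConnected.transfer`): equations and rules are only replaced by conversions
through terms below one of their sides, a (pending) rule `ℓ → r` always leaves behind some step `ℓ → w` with
`w` and `r` connected below `ℓ`, and reducible terms stay reducible, so that overlaps that were not
prime when critical pairs were computed are not prime later. For the new rule the overlaps are
connected by the deduced equations and pending rules (`LocallyConnected.insert_rule`). When
no equation and no pending rule is left, this is the confluence criterion for the final system.

Interreduction of the rules is maintained separately (`Interreduced.of_iteration`). That right-hand
sides are normal forms of rewriting modulo AC, and not only of plain rewriting, follows from
completeness (`CompleteMod.not_stepMod_of_nf`).

Apart from the tool itself, everything is proved for an arbitrary theory `B` of linear equations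
between non-variable terms with the same variables (`LinearRegular`).
-/

namespace LLAC

open FirstOrder.Language

universe u v w

/-! ### Terms, contexts and substitutions -/

section TermLemmas

variable {L : FirstOrder.Language.{u, v}} {V : Type w}

@[simp] theorem subst_var (x : V) (σ : V → L.Term V) :
    (Term.var x : L.Term V).subst σ = σ x := rfl

@[simp] theorem subst_func {n : ℕ} (f : L.Functions n) (ts : Fin n → L.Term V)
    (σ : V → L.Term V) :
    (Term.func f ts).subst σ = Term.func f (fun i => (ts i).subst σ) := rfl

@[simp] theorem vars_var (x : V) : vars (Term.var x : L.Term V) = {x} := by rw [vars]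

@[simp] theorem vars_func {n : ℕ} (f : L.Functions n) (ts : Fin n → L.Term V) :
    vars (Term.func f ts) = ⋃ i, vars (ts i) := by rw [vars]

@[simp] theorem linear_var (x : V) : Linear (Term.var x : L.Term V) := by rw [Linear]; trivial

@[simp] theorem linear_func {n : ℕ} (f : L.Functions n) (ts : Fin n → L.Term V) :
    Linear (Term.func f ts) ↔
      (∀ i, Linear (ts i)) ∧ ∀ i j, i ≠ j → Disjoint (vars (ts i)) (vars (ts j)) := by
  rw [Linear]

@[simp] theorem fill_hole (t : L.Term V) : (Ctx.hole : Ctx L V).fill t = t := rfl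

@[simp] theorem fill_app {n : ℕ} (f : L.Functions n) (i : Fin n) (ts : Fin n → L.Term V)
    (C : Ctx L V) (t : L.Term V) :
    (Ctx.app f i ts C).fill t = Term.func f (Function.update ts i (C.fill t)) := rfl

theorem vars_finite (t : L.Term V) : (vars t).Finite := by
  induction t with
  | var x => simp
  | func f ts ih => simpa using Set.finite_iUnion ih

theorem subst_subst (t : L.Term V) (σ τ : V → L.Term V) :
    (t.subst σ).subst τ = t.subst (fun x => (σ x).subst τ) := by
  induction t with
  | var x => rfl
  | func f ts ih => simp [ih]

theorem subst_var_self (t : L.Term V) : t.subst Term.var = t := by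
  induction t with
  | var x => rfl
  | func f ts ih => simp [ih]

theorem relabel_eq_subst (t : L.Term V) (π : V → V) :
    t.relabel π = t.subst (fun x => Term.var (π x)) := by
  induction t with
  | var x => rfl
  | func f ts ih => simp [ih]

theorem vars_subst (t : L.Term V) (σ : V → L.Term V) :
    vars (t.subst σ) = ⋃ x ∈ vars t, vars (σ x) := by
  induction t with
  | var x => simp
  | func f ts ih =>
    ext y
    simp only [subst_func, vars_func, ih, Set.mem_iUnion]
    constructor
    · rintro ⟨i, x, hx, hy⟩; exact ⟨x, ⟨i, hx⟩, hy⟩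
    · rintro ⟨x, ⟨i, hx⟩, hy⟩; exact ⟨i, x, hx, hy⟩

theorem vars_relabel (t : L.Term V) (π : V → V) : vars (t.relabel π) = π '' vars t := by
  rw [relabel_eq_subst, vars_subst]
  ext y
  simp [eq_comm]

/-- Two substitutions agree on a term iff they agree on its variables. -/
theorem subst_eq_subst_iff (t : L.Term V) (σ τ : V → L.Term V) :
    t.subst σ = t.subst τ ↔ ∀ x ∈ vars t, σ x = τ x := by
  induction t with
  | var x => simp
  | func f ts ih =>
    simp only [subst_func, Term.func.injEq, heq_eq_eq, true_and, funext_iff, ih, vars_func,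
      Set.mem_iUnion]
    constructor
    · rintro h x ⟨i, hx⟩; exact h i x hx
    · intro h i x hx; exact h x ⟨i, hx⟩

theorem linear_relabel {t : L.Term V} (ht : Linear t) (π : Equiv.Perm V) :
    Linear (t.relabel π) := by
  induction t with
  | var x => simp
  | func f ts ih =>
    simp only [Term.relabel, linear_func] at ht ⊢
    refine ⟨fun i => ih i (ht.1 i), fun i j hij => ?_⟩
    rw [vars_relabel, vars_relabel, Set.disjoint_image_iff π.injective]
    exact ht.2 i j hij

/-- Composition of contexts. -/
def Ctx.comp : Ctx L V → Ctx L V → Ctx L V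
  | .hole, D => D
  | .app f i ts C, D => .app f i ts (C.comp D)

theorem fill_comp (C D : Ctx L V) (t : L.Term V) : (C.comp D).fill t = C.fill (D.fill t) := by
  induction C with
  | hole => rfl
  | app f i ts C ih => simp [Ctx.comp, ih]

theorem comp_eq_hole {C D : Ctx L V} (h : C.comp D = .hole) : C = .hole ∧ D = .hole := by
  cases C with
  | hole => exact ⟨rfl, h⟩
  | app f i ts C => simp [Ctx.comp] at h

theorem fill_subst (C : Ctx L V) (t : L.Term V) (σ : V → L.Term V) :
    (C.fill t).subst σ = (C.subst σ).fill (t.subst σ) := by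
  induction C with
  | hole => rfl
  | app f i ts C ih =>
    simp only [fill_app, subst_func, Ctx.subst, Term.func.injEq, heq_eq_eq, true_and]
    funext j
    by_cases hj : j = i
    · subst hj; simp [ih]
    · simp [hj]

theorem ctx_subst_subst (C : Ctx L V) (σ τ : V → L.Term V) :
    (C.subst σ).subst τ = C.subst (fun x => (σ x).subst τ) := by
  induction C with
  | hole => rfl
  | app f i ts C ih => simp [Ctx.subst, ih, subst_subst]

theorem ctx_subst_ne_hole {C : Ctx L V} (h : C ≠ .hole) (σ : V → L.Term V) :
    C.subst σ ≠ .hole := by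
  cases C with
  | hole => exact absurd rfl h
  | app f i ts C => simp [Ctx.subst]

theorem vars_fill_hole_subset (C : Ctx L V) (t : L.Term V) : vars t ⊆ vars (C.fill t) := by
  induction C with
  | hole => exact subset_rfl
  | app f i ts C ih =>
    refine ih.trans fun x hx => ?_
    simp only [fill_app, vars_func, Set.mem_iUnion]
    exact ⟨i, by simpa using hx⟩

/-- Instances of a context only depend on the variables of the filled context, not on those of the
irrelevant argument stored at the hole. -/
theorem fill_subst_congr {C : Ctx L V} {b : L.Term V} {σ τ : V → L.Term V}
    (h : ∀ x ∈ vars (C.fill b), σ x = τ x) (t : L.Term V) :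
    (C.subst σ).fill t = (C.subst τ).fill t := by
  induction C with
  | hole => rfl
  | app f i ts C ih =>
    simp only [fill_app, vars_func, Set.mem_iUnion] at h
    simp only [Ctx.subst, fill_app, Term.func.injEq, heq_eq_eq, true_and]
    funext j
    by_cases hj : j = i
    · subst hj
      simpa using ih fun x hx => h x ⟨j, by simpa using hx⟩
    · simp only [Function.update_of_ne hj]
      exact (subst_eq_subst_iff _ _ _).2 fun x hx => h x ⟨j, by simpa [hj] using hx⟩

theorem vars_fill_mono (C : Ctx L V) {s t : L.Term V} (h : vars s ⊆ vars t) :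
    vars (C.fill s) ⊆ vars (C.fill t) := by
  induction C with
  | hole => exact h
  | app f i ts C ih =>
    simp only [fill_app, vars_func]
    refine Set.iUnion_mono fun j => ?_
    by_cases hj : j = i
    · subst hj; simpa using ih
    · simp [hj]

theorem vars_subst_mono {s t : L.Term V} (h : vars s ⊆ vars t) (σ : V → L.Term V) :
    vars (s.subst σ) ⊆ vars (t.subst σ) := by
  rw [vars_subst, vars_subst]
  exact Set.biUnion_subset_biUnion_left h

/-- Every variable of `C[r]` not in `r` comes from `C`, hence is a variable of `C[b]`; if `C[b]` is
linear, it is not a variable of `b`. -/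
theorem vars_fill_of_linear {C : Ctx L V} {b r : L.Term V} (hl : Linear (C.fill b)) {x : V}
    (hx : x ∈ vars (C.fill r)) : x ∈ vars r ∨ (x ∈ vars (C.fill b) ∧ x ∉ vars b) := by
  induction C with
  | hole => exact Or.inl hx
  | app f i ts C ih =>
    simp only [fill_app, linear_func, vars_func, Set.mem_iUnion] at hl hx ⊢
    obtain ⟨j, hj⟩ := hx
    by_cases hji : j = i
    · subst hji
      rcases ih (by simpa using hl.1 j) (by simpa using hj) with h | ⟨h, h'⟩
      · exact Or.inl h
      · exact Or.inr ⟨⟨j, by simpa using h⟩, h'⟩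
    · refine Or.inr ⟨⟨j, by simpa [hji] using hj⟩, fun hb => ?_⟩
      have hxj : x ∈ vars (Function.update ts i (C.fill b) j) := by simpa [hji] using hj
      exact Set.disjoint_left.1 (hl.2 j i hji) hxj (by simpa using vars_fill_hole_subset C b hb)

/-- Replacing the hole of a linear term by a linear term with fresh variables preserves
linearity. -/
theorem linear_fill {C : Ctx L V} {b r : L.Term V} (hl : Linear (C.fill b)) (hr : Linear r)
    (hd : Disjoint (vars r) (vars (C.fill b))) : Linear (C.fill r) := by
  induction C with
  | hole => exact hr
  | app f i ts C ih =>
    simp only [fill_app, linear_func, vars_func] at hl hd ⊢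
    have hi : Linear (C.fill b) := by simpa using hl.1 i
    have hdi : ∀ j, Disjoint (vars r) (vars (Function.update ts i (C.fill b) j)) := fun j =>
      hd.mono_right (Set.subset_iUnion (fun j => vars (Function.update ts i (C.fill b) j)) j)
    have key : ∀ j, j ≠ i → Disjoint (vars (C.fill r)) (vars (ts j)) := by
      intro j hj
      rw [Set.disjoint_left]
      intro x hx hxj
      rcases vars_fill_of_linear hi hx with h | ⟨h, -⟩
      · exact Set.disjoint_left.1 (hdi j) h (by simpa [hj] using hxj)
      · exact Set.disjoint_left.1 (hl.2 i j hj.symm) (by simpa using h) (by simpa [hj] using hxj)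
    constructor
    · intro j
      by_cases hj : j = i
      · subst hj; simpa using ih hi (by simpa using hdi j)
      · simpa [hj] using hl.1 j
    · intro j k hjk
      by_cases hj : j = i
      · subst hj; simpa [hjk.symm] using key k hjk.symm
      · by_cases hk : k = i
        · subst hk; simpa [hj] using (key j hj).symm
        · simpa [hj, hk] using hl.2 j k hjk

theorem linear_of_linear_fill {C : Ctx L V} {b : L.Term V} (hl : Linear (C.fill b)) :
    Linear b := by
  induction C with
  | hole => exact hl
  | app f i ts C ih => exact ih (by simpa using hl.1 i)

theorem exists_fill_var_of_mem_vars {t : L.Term V} {x : V} (hx : x ∈ vars t) :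
    ∃ C : Ctx L V, t = C.fill (.var x) := by
  induction t with
  | var y => exact ⟨.hole, by simp_all⟩
  | func f ts ih =>
    obtain ⟨i, hi⟩ := by simpa using hx
    obtain ⟨C, hC⟩ := ih i hi
    exact ⟨.app f i ts C, by simp [← hC]⟩

open Classical in
/-- In a linear term, changing the value of a variable changes the instance at one position. -/
theorem subst_update_of_linear {D : Ctx L V} {x : V} (hl : Linear (D.fill (.var x)))
    (τ : V → L.Term V) (a : L.Term V) :
    (D.fill (.var x)).subst (Function.update τ x a) = (D.subst τ).fill a := by
  have key : ∀ D : Ctx L V, Linear (D.fill (.var x)) →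
      (D.subst (Function.update τ x a)).fill a = (D.subst τ).fill a := by
    intro D
    induction D with
    | hole => intro _; rfl
    | app f i ts C ih =>
      intro hl
      simp only [fill_app, linear_func] at hl
      simp only [Ctx.subst, fill_app, Term.func.injEq, heq_eq_eq, true_and]
      funext j
      by_cases hj : j = i
      · subst hj; simpa using ih (by simpa using hl.1 j)
      · simp only [Function.update_of_ne hj]
        refine (subst_eq_subst_iff _ _ _).2 fun y hy => ?_
        have hxy : y ≠ x := by
          rintro rfl
          have hyj : y ∈ vars (Function.update ts i (C.fill (.var y)) j) := by simpa [hj] using hy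
          refine Set.disjoint_left.1 (hl.2 j i hj) hyj ?_
          simpa using vars_fill_hole_subset C (.var y) (by simp)
        simp [hxy]
  rw [fill_subst, subst_var, Function.update_self, key D hl]

/-- Two positions in a term are comparable or parallel. In the parallel case the term is
`F a₁ a₂` for a function `F` that is a context in each argument. -/
theorem fill_eq_fill {C₁ C₂ : Ctx L V} {a₁ a₂ : L.Term V} (h : C₁.fill a₁ = C₂.fill a₂) :
    (∃ D : Ctx L V, a₁ = D.fill a₂ ∧ ∀ x, C₂.fill x = C₁.fill (D.fill x)) ∨
    (∃ D : Ctx L V, a₂ = D.fill a₁ ∧ ∀ x, C₁.fill x = C₂.fill (D.fill x)) ∨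
    ∃ F : L.Term V → L.Term V → L.Term V,
      (∀ x, C₁.fill x = F x a₂) ∧ (∀ y, C₂.fill y = F a₁ y) ∧
      (∀ x, ∃ C : Ctx L V, ∀ y, F x y = C.fill y) ∧ ∀ y, ∃ C : Ctx L V, ∀ x, F x y = C.fill x := by
  induction C₁ generalizing C₂ with
  | hole => exact Or.inl ⟨C₂, h, fun x => rfl⟩
  | app f i ts C₁ ih =>
    cases C₂ with
    | hole => exact Or.inr (Or.inl ⟨.app f i ts C₁, h.symm, fun x => rfl⟩)
    | @app n g j us C₂ =>
      simp only [fill_app, Term.func.injEq] at h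
      obtain ⟨rfl, hfg, h⟩ := h
      obtain rfl := eq_of_heq hfg
      replace h := congrFun (eq_of_heq h)
      by_cases hij : i = j
      · subst hij
        have hu : ∀ x, Function.update us i x = Function.update ts i x := by
          intro x; funext k
          by_cases hk : k = i
          · subst hk; simp
          · simpa [hk] using (h k).symm
        rcases ih (by simpa using h i) with ⟨D, h₁, h₂⟩ | ⟨D, h₁, h₂⟩ | ⟨F, h₁, h₂, h₃, h₄⟩
        · exact Or.inl ⟨D, h₁, fun x => by simp [h₂, hu]⟩
        · exact Or.inr (Or.inl ⟨D, h₁, fun x => by simp [h₂, hu]⟩)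
        · refine Or.inr (Or.inr ⟨fun x y => .func f (Function.update ts i (F x y)),
            fun x => by simp [h₁], fun y => by simp [h₂, hu], fun x => ?_, fun y => ?_⟩)
          · obtain ⟨C, hC⟩ := h₃ x
            exact ⟨.app f i ts C, fun y => by simp [hC]⟩
          · obtain ⟨C, hC⟩ := h₄ y
            exact ⟨.app f i ts C, fun x => by simp [hC]⟩
      · have hji : j ≠ i := fun e => hij e.symm
        have e₁ : us i = C₁.fill a₁ := by simpa [hij] using (h i).symm
        have e₂ : ts j = C₂.fill a₂ := by simpa [hji] using h j
        refine Or.inr (Or.inr ⟨fun x y =>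
          .func f (Function.update (Function.update ts i (C₁.fill x)) j (C₂.fill y)),
            fun x => ?_, fun y => ?_, fun x => ?_, fun y => ?_⟩)
        · simp only [fill_app, ← e₂, Term.func.injEq, heq_eq_eq, true_and]
          funext k
          by_cases hk : k = j
          · subst hk; simp [hji]
          · simp [hk]
        · simp only [fill_app, Term.func.injEq, heq_eq_eq, true_and]
          funext k
          by_cases hk : k = j
          · subst hk; simp
          · by_cases hki : k = i
            · subst hki; simp [hk, e₁]
            · simpa [hk, hki] using (h k).symm
        · exact ⟨.app f j (Function.update ts i (C₁.fill x)) C₂, fun y => rfl⟩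
        · exact ⟨.app f i (Function.update ts j (C₂.fill y)) C₁, fun x => by
            simp [Function.update_comm hij]⟩

/-- A subterm of an instance `ℓτ` overlaps with `ℓ` at a non-variable position or lies inside the
value of a variable. -/
theorem subst_eq_fill {l a : L.Term V} {τ : V → L.Term V} {D : Ctx L V}
    (h : l.subst τ = D.fill a) :
    (∃ (D' : Ctx L V) (b : L.Term V), l = D'.fill b ∧ (∀ x, b ≠ .var x) ∧ b.subst τ = a ∧
      ∀ y, D.fill y = (D'.subst τ).fill y) ∨
    ∃ (x : V) (D₁ D₂ : Ctx L V), l = D₁.fill (.var x) ∧ τ x = D₂.fill a ∧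
      ∀ y, D.fill y = (D₁.subst τ).fill (D₂.fill y) := by
  induction l generalizing D with
  | var x => exact Or.inr ⟨x, .hole, D, rfl, h, fun y => rfl⟩
  | func f ts ih =>
    cases D with
    | hole => exact Or.inl ⟨.hole, .func f ts, rfl, by simp, h, fun y => rfl⟩
    | @app n g i us D =>
      simp only [subst_func, fill_app, Term.func.injEq] at h
      obtain ⟨rfl, hfg, h⟩ := h
      obtain rfl := eq_of_heq hfg
      replace h := congrFun (eq_of_heq h)
      have hu : ∀ x, Function.update us i x = Function.update (fun j => (ts j).subst τ) i x := by
        intro x; funext k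
        by_cases hk : k = i
        · subst hk; simp
        · simpa [hk] using (h k).symm
      rcases ih i (by simpa using h i) with ⟨D', b, h₁, h₂, h₃, h₄⟩ | ⟨x, D₁, D₂, h₁, h₂, h₃⟩
      · exact Or.inl ⟨.app f i ts D', b, by simp [← h₁], h₂, h₃, fun y => by
          simp [Ctx.subst, h₄, hu]⟩
      · exact Or.inr ⟨x, .app f i ts D₁, D₂, by simp [← h₁], h₂, fun y => by
          simp [Ctx.subst, h₃, hu]⟩

end TermLemmas

/-! ### Rewriting modulo a theory and the induced reduction order -/

section Closures

variable {α β : Type*} {r : α → α → Prop} {p : β → β → Prop} (f : α → β)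

theorem reflTransGen_map (h : ∀ a b, r a b → p (f a) (f b)) {a b : α}
    (hab : Relation.ReflTransGen r a b) : Relation.ReflTransGen p (f a) (f b) := by
  induction hab with
  | refl => exact .refl
  | tail _ h' ih => exact ih.tail (h _ _ h')

theorem transGen_map (h : ∀ a b, r a b → p (f a) (f b)) {a b : α}
    (hab : Relation.TransGen r a b) : Relation.TransGen p (f a) (f b) := by
  induction hab with
  | single h' => exact .single (h _ _ h')
  | tail _ h' ih => exact ih.tail (h _ _ h')

end Closures

section Orders

variable {L : FirstOrder.Language.{u, v}} {V : Type w}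

theorem Step.mono {A A' : Set (TPair L V)} (h : A ⊆ A') {s t : L.Term V} (hs : Step A s t) :
    Step A' s t := by
  obtain ⟨q, hq, r⟩ := hs
  exact ⟨q, h hq, r⟩

theorem Step.of_mem {A : Set (TPair L V)} {q : TPair L V} (hq : q ∈ A) : Step A q.1 q.2 :=
  ⟨q, hq, .hole, Term.var, by simp [subst_var_self], by simp [subst_var_self]⟩

theorem Step.fill {A : Set (TPair L V)} {s t : L.Term V} (hs : Step A s t) (C : Ctx L V) :
    Step A (C.fill s) (C.fill t) := by
  obtain ⟨q, hq, D, σ, rfl, rfl⟩ := hs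
  exact ⟨q, hq, C.comp D, σ, by rw [fill_comp], by rw [fill_comp]⟩

theorem Step.subst {A : Set (TPair L V)} {s t : L.Term V} (hs : Step A s t) (τ : V → L.Term V) :
    Step A (s.subst τ) (t.subst τ) := by
  obtain ⟨q, hq, D, σ, rfl, rfl⟩ := hs
  exact ⟨q, hq, D.subst τ, fun x => (σ x).subst τ, by rw [fill_subst, subst_subst],
    by rw [fill_subst, subst_subst]⟩

theorem step_union {A A' : Set (TPair L V)} {s t : L.Term V} :
    Step (A ∪ A') s t ↔ Step A s t ∨ Step A' s t := by
  constructor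
  · rintro ⟨q, hq | hq, r⟩
    · exact Or.inl ⟨q, hq, r⟩
    · exact Or.inr ⟨q, hq, r⟩
  · rintro (h | h)
    · exact h.mono Set.subset_union_left
    · exact h.mono Set.subset_union_right

theorem step_swap {A : Set (TPair L V)} {s t : L.Term V} :
    Step (Prod.swap '' A) s t ↔ Step A t s := by
  constructor
  · rintro ⟨_, ⟨q, hq, rfl⟩, C, σ, h₁, h₂⟩
    exact ⟨q, hq, C, σ, h₂, h₁⟩
  · rintro ⟨q, hq, C, σ, h₁, h₂⟩
    exact ⟨q.swap, ⟨q, hq, rfl⟩, C, σ, h₂, h₁⟩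

theorem step_symm {A : Set (TPair L V)} {s t : L.Term V} :
    Step (symm A) s t ↔ Step A s t ∨ Step A t s := by
  rw [symm, step_union, step_swap]

theorem NF.of_fill {A : Set (TPair L V)} {C : Ctx L V} {t : L.Term V} (h : NF A (C.fill t)) :
    NF A t := fun _ hu => h _ (hu.fill C)

theorem NF.of_subst {A : Set (TPair L V)} {t : L.Term V} {σ : V → L.Term V}
    (h : NF A (t.subst σ)) : NF A t := fun _ hu => h _ (hu.subst σ)

/-- Irreducibility only depends on the left-hand sides, up to reducibility of these. -/
theorem NF.of_lhs {A A' : Set (TPair L V)} (h : ∀ q ∈ A, ¬ NF A' q.1) {t : L.Term V}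
    (ht : NF A' t) : NF A t := by
  rintro _ ⟨q, hq, C, σ, rfl, -⟩
  exact h q hq (ht.of_fill.of_subst)

theorem NF.mono {A A' : Set (TPair L V)} (h : A ⊆ A') {t : L.Term V} (ht : NF A' t) : NF A t :=
  fun _ hu => ht _ (hu.mono h)

theorem Conv.fill {A : Set (TPair L V)} {s t : L.Term V} (h : Conv A s t) (C : Ctx L V) :
    Conv A (C.fill s) (C.fill t) := by
  induction h with
  | rel x y h => exact .rel _ _ (h.fill C)
  | refl x => exact .refl _
  | symm x y _ ih => exact .symm _ _ ih
  | trans x y z _ _ h₁ h₂ => exact .trans _ _ _ h₁ h₂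

theorem Conv.subst {A : Set (TPair L V)} {s t : L.Term V} (h : Conv A s t) (σ : V → L.Term V) :
    Conv A (s.subst σ) (t.subst σ) := by
  induction h with
  | rel x y h => exact .rel _ _ (h.subst σ)
  | refl x => exact .refl _
  | symm x y _ ih => exact .symm _ _ ih
  | trans x y z _ _ h₁ h₂ => exact .trans _ _ _ h₁ h₂

theorem Conv.refl {A : Set (TPair L V)} (s : L.Term V) : Conv A s s := Relation.EqvGen.refl _

theorem Conv.symm {A : Set (TPair L V)} {s t : L.Term V} (h : Conv A s t) : Conv A t s :=
  Relation.EqvGen.symm _ _ h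

theorem Conv.trans {A : Set (TPair L V)} {s t u : L.Term V} (h : Conv A s t) (h' : Conv A t u) :
    Conv A s u := Relation.EqvGen.trans _ _ _ h h'

theorem Conv.of_step {A : Set (TPair L V)} {s t : L.Term V} (h : Step A s t) : Conv A s t :=
  Relation.EqvGen.rel _ _ h

theorem Conv.of_symm_step {A : Set (TPair L V)} {s t : L.Term V} (h : Step (LLAC.symm A) s t) :
    Conv A s t := by
  rcases step_symm.1 h with h | h
  · exact .of_step h
  · exact (Conv.of_step h).symm

/-- To embed an equational theory into another it suffices to derive its axioms. -/
theorem Conv.transfer {A A' : Set (TPair L V)} (h : ∀ q ∈ A, Conv A' q.1 q.2) {s t : L.Term V}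
    (hs : Conv A s t) : Conv A' s t := by
  induction hs with
  | rel x y h' =>
    obtain ⟨q, hq, C, σ, rfl, rfl⟩ := h'
    exact ((h q hq).subst σ).fill C
  | refl x => exact .refl _
  | symm x y _ ih => exact ih.symm
  | trans x y z _ _ h₁ h₂ => exact h₁.trans h₂

theorem Conv.mono {A A' : Set (TPair L V)} (h : A ⊆ A') {s t : L.Term V}
    (hs : Conv A s t) : Conv A' s t :=
  hs.transfer fun _ hq => .of_step (.of_mem (h hq))

/-- A compatible reflexive and transitive relation on the values of two substitutions extends to
the instances of terms. -/
theorem subst_congr_of_compatible {r : L.Term V → L.Term V → Prop} (hrefl : ∀ t, r t t)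
    (htrans : ∀ {a b c}, r a b → r b c → r a c)
    (hfill : ∀ {a b} (C : Ctx L V), r a b → r (C.fill a) (C.fill b))
    {σ τ : V → L.Term V} (h : ∀ x, r (σ x) (τ x)) (t : L.Term V) :
    r (t.subst σ) (t.subst τ) := by
  classical
  induction t with
  | var x => exact h x
  | @func n f ts ih =>
    -- The arguments are exchanged one after the other, over the set of indices already treated.
    have key : ∀ S : Finset (Fin n), r (.func f fun i => (ts i).subst σ)
        (.func f fun i => if i ∈ S then (ts i).subst τ else (ts i).subst σ) := by
      intro S
      induction S using Finset.induction_on with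
      | empty => simpa using hrefl _
      | insert i S hi ihS =>
        refine htrans ihS ?_
        have := hfill (.app f i (fun j => if j ∈ S then (ts j).subst τ else (ts j).subst σ) .hole)
          (ih i)
        simp only [fill_app, fill_hole] at this
        convert this using 2
        · funext j
          by_cases hj : j = i
          · subst hj; simp [hi]
          · simp [hj]
        · funext j
          by_cases hj : j = i
          · subst hj; simp
          · simp [hj]
    simpa using key Finset.univ

theorem StepMod.of_step {B R : Set (TPair L V)} {s t : L.Term V} (h : Step R s t) :
    StepMod B R s t := ⟨s, t, .refl _, h, .refl _⟩

theorem StepMod.fill {B R : Set (TPair L V)} {s t : L.Term V} (h : StepMod B R s t)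
    (C : Ctx L V) : StepMod B R (C.fill s) (C.fill t) := by
  obtain ⟨a, b, h₁, h₂, h₃⟩ := h
  exact ⟨_, _, h₁.fill C, h₂.fill C, h₃.fill C⟩

theorem StepMod.subst {B R : Set (TPair L V)} {s t : L.Term V} (h : StepMod B R s t)
    (σ : V → L.Term V) : StepMod B R (s.subst σ) (t.subst σ) := by
  obtain ⟨a, b, h₁, h₂, h₃⟩ := h
  exact ⟨_, _, h₁.subst σ, h₂.subst σ, h₃.subst σ⟩

theorem StepPS.stepMod {B R : Set (TPair L V)} {s t : L.Term V} (h : StepPS B R s t) :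
    StepMod B R s t := by
  obtain ⟨q, hq, C, σ, a, rfl, h, rfl⟩ := h
  exact ⟨_, _, h.fill C, ⟨q, hq, C, σ, rfl, rfl⟩, .refl _⟩

/-- The strict order `→⁺_{C/B}` induced by a system `C`. -/
def Gt (B C : Set (TPair L V)) : L.Term V → L.Term V → Prop := Relation.TransGen (StepMod B C)

/-- The quasi-order `→⁺_{C/B} ∪ ∼_B`. -/
def Ge (B C : Set (TPair L V)) (s t : L.Term V) : Prop := Conv B s t ∨ Gt B C s t

variable {B C : Set (TPair L V)}

theorem Gt.trans {s t u : L.Term V} (h : Gt B C s t) (h' : Gt B C t u) : Gt B C s u :=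
  Relation.TransGen.trans h h'

theorem Gt.of_conv_left {s t u : L.Term V} (h : Conv B s t) (h' : Gt B C t u) : Gt B C s u := by
  induction h' with
  | single h' =>
    obtain ⟨a, b, h₁, h₂, h₃⟩ := h'
    exact .single ⟨a, b, h.trans h₁, h₂, h₃⟩
  | tail _ h₂ ih => exact .tail ih h₂

theorem Gt.conv_right {s t u : L.Term V} (h : Gt B C s t) (h' : Conv B t u) : Gt B C s u := by
  cases h with
  | single h =>
    obtain ⟨a, b, h₁, h₂, h₃⟩ := h
    exact .single ⟨a, b, h₁, h₂, h₃.trans h'⟩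
  | tail h₀ h =>
    obtain ⟨a, b, h₁, h₂, h₃⟩ := h
    exact .tail h₀ ⟨a, b, h₁, h₂, h₃.trans h'⟩

theorem Gt.fill {s t : L.Term V} (h : Gt B C s t) (D : Ctx L V) :
    Gt B C (D.fill s) (D.fill t) := transGen_map D.fill (fun _ _ h => h.fill D) h

theorem Gt.subst {s t : L.Term V} (h : Gt B C s t) (σ : V → L.Term V) :
    Gt B C (s.subst σ) (t.subst σ) :=
  transGen_map (fun t : L.Term V => t.subst σ) (fun _ _ h => StepMod.subst h σ) h

theorem Ge.refl (s : L.Term V) : Ge B C s s := Or.inl (.refl _)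

theorem Gt.ge_right {s t u : L.Term V} (h : Gt B C s t) (h' : Ge B C t u) : Gt B C s u :=
  h'.elim h.conv_right h.trans

theorem Ge.gt_right {s t u : L.Term V} (h : Ge B C s t) (h' : Gt B C t u) : Gt B C s u :=
  h.elim (fun h => h'.of_conv_left h) (fun h => h.trans h')

theorem Ge.trans {s t u : L.Term V} (h : Ge B C s t) (h' : Ge B C t u) : Ge B C s u := by
  rcases h' with h' | h'
  · exact h.elim (fun h => Or.inl (h.trans h')) (fun h => Or.inr (h.conv_right h'))
  · exact Or.inr (h.gt_right h')

theorem Ge.fill {s t : L.Term V} (h : Ge B C s t) (D : Ctx L V) :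
    Ge B C (D.fill s) (D.fill t) := h.imp (fun h => h.fill D) (fun h => h.fill D)

theorem Ge.subst {s t : L.Term V} (h : Ge B C s t) (σ : V → L.Term V) :
    Ge B C (s.subst σ) (t.subst σ) := h.imp (fun h => h.subst σ) (fun h => h.subst σ)

theorem Gt.wellFounded (h : TerminatingMod B C) : WellFounded (fun a b => Gt B C b a) := by
  have h₁ : WellFounded (Function.swap (StepMod B C)) := by
    rw [wellFounded_iff_isEmpty_descending_chain]
    exact ⟨fun f => h ⟨f.1, f.2⟩⟩
  have h₂ := h₁.transGen
  refine Subrelation.wf (fun {a b} hab => ?_) h₂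
  exact Relation.transGen_swap.2 hab

theorem Gt.irrefl (h : TerminatingMod B C) (s : L.Term V) : ¬ Gt B C s s := fun hs =>
  (Gt.wellFounded h).irrefl.irrefl s hs

/-- All rules of `R` are decreasing for the order induced by `C`. -/
def Decreasing (B C R : Set (TPair L V)) : Prop := ∀ q ∈ R, Gt B C q.1 q.2

theorem Decreasing.step {R : Set (TPair L V)} (h : Decreasing B C R) {s t : L.Term V}
    (hs : Step R s t) : Gt B C s t := by
  obtain ⟨q, hq, D, σ, rfl, rfl⟩ := hs
  exact ((h q hq).subst σ).fill D

theorem Decreasing.stepMod {R : Set (TPair L V)} (h : Decreasing B C R) {s t : L.Term V}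
    (hs : StepMod B R s t) : Gt B C s t := by
  obtain ⟨a, b, h₁, h₂, h₃⟩ := hs
  exact ((h.step h₂).of_conv_left h₁).conv_right h₃

theorem Decreasing.steps {R : Set (TPair L V)} (h : Decreasing B C R) {s t : L.Term V}
    (hs : Relation.ReflTransGen (StepMod B R) s t) : Ge B C s t := by
  induction hs with
  | refl => exact .refl _
  | tail _ h' ih => exact ih.trans (Or.inr (h.stepMod h'))

theorem Decreasing.terminating {R : Set (TPair L V)} (h : Decreasing B C R)
    (hC : TerminatingMod B C) : TerminatingMod B R := by
  rintro ⟨f, hf⟩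
  exact (wellFounded_iff_isEmpty_descending_chain.1 (Gt.wellFounded hC)).false
    ⟨f, fun n => h.stepMod (hf n)⟩

/-! ### Conversions through terms with a given property -/

/-- A conversion with the equations in `A`, all of whose terms satisfy `X` (the empty conversion is
unrestricted). -/
def ConvIn (X : L.Term V → Prop) (A : Set (TPair L V)) : L.Term V → L.Term V → Prop :=
  Relation.ReflTransGen fun a b => X a ∧ X b ∧ (Step A a b ∨ Step A b a)

variable {X Y : L.Term V → Prop} {A A' : Set (TPair L V)}

theorem ConvIn.refl (a : L.Term V) : ConvIn X A a a := Relation.ReflTransGen.refl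

theorem ConvIn.of_eq {a b : L.Term V} (h : a = b) : ConvIn X A a b := h ▸ ConvIn.refl a

theorem ConvIn.trans {a b c : L.Term V} (h : ConvIn X A a b) (h' : ConvIn X A b c) :
    ConvIn X A a c := Relation.ReflTransGen.trans h h'

theorem ConvIn.symm {a b : L.Term V} (h : ConvIn X A a b) : ConvIn X A b a := by
  induction h with
  | refl => exact .refl _
  | tail _ h ih => exact .head ⟨h.2.1, h.1, h.2.2.symm⟩ ih

theorem ConvIn.of_step {a b : L.Term V} (h : Step A a b) (ha : X a) (hb : X b) :
    ConvIn X A a b := .single ⟨ha, hb, Or.inl h⟩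

theorem ConvIn.mono {a b : L.Term V} (h : ConvIn X A a b) (hX : ∀ x, X x → Y x) :
    ConvIn Y A a b :=
  reflTransGen_map id (fun _ _ h => ⟨hX _ h.1, hX _ h.2.1, h.2.2⟩) h

theorem ConvIn.conv {a b : L.Term V} (h : ConvIn X A a b) : Conv A a b := by
  induction h with
  | refl => exact .refl _
  | tail _ h ih =>
    exact ih.trans (h.2.2.elim (fun h => .of_step h) fun h => (Conv.of_step h).symm)

theorem ConvIn.instantiate {a b : L.Term V} (h : ConvIn X A a b) (D : Ctx L V) (σ : V → L.Term V)
    (hXY : ∀ x, X x → Y (D.fill (x.subst σ))) :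
    ConvIn Y A (D.fill (a.subst σ)) (D.fill (b.subst σ)) :=
  reflTransGen_map (fun x : L.Term V => D.fill (x.subst σ))
    (fun _ _ h => ⟨hXY _ h.1, hXY _ h.2.1,
      h.2.2.imp (fun h => (h.subst σ).fill D) (fun h => (h.subst σ).fill D)⟩) h

theorem ConvIn.of_conv (hB : B ⊆ A) {a b s : L.Term V} (h : Conv B a b) (hs : Conv B s a) :
    ConvIn (Conv B s) A a b := by
  induction h generalizing s with
  | rel x y h => exact .of_step (h.mono hB) hs (hs.trans (.of_step h))
  | refl x => exact .refl _
  | symm x y h ih => exact (ih (hs.trans (Conv.symm h))).symm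
  | trans x y z h _ h₁ h₂ => exact (h₁ hs).trans (h₂ (hs.trans h))

/-- Equivalent terms below `s` are connected below `s`. -/
theorem ConvIn.of_conv_gt (hB : B ⊆ A) {a b s : L.Term V} (h : Conv B a b) (hs : Gt B C s a) :
    ConvIn (Gt B C s) A a b :=
  (ConvIn.of_conv hB h (.refl _)).mono fun _ hx => hs.conv_right hx

/-- If every rewrite step from a term below `s` is replaced by a conversion below its source, a
rewrite sequence modulo `B` from `s` is replaced by a conversion below `s`. -/
theorem ConvIn.of_steps_of {R : Set (TPair L V)} (hR : Decreasing B C R) (hB : B ⊆ A)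
    {s t : L.Term V} (hA : ∀ p q, Ge B C s p → Step R p q → ConvIn (Ge B C p) A p q)
    (h : Relation.ReflTransGen (StepMod B R) s t) : ConvIn (Ge B C s) A s t := by
  induction h with
  | refl => exact .refl _
  | @tail b c h h' ih =>
    have hsb := hR.steps h
    obtain ⟨p, q, h₁, h₂, h₃⟩ := h'
    have hsp : Ge B C s p := hsb.trans (Or.inl h₁)
    have hsq : Ge B C s q := hsp.trans (Or.inr (hR.step h₂))
    exact ih.trans (((ConvIn.of_conv hB h₁ (.refl _)).mono fun x hx => hsb.trans (Or.inl hx)).trans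
      (((hA p q hsp h₂).mono fun x hx => hsp.trans hx).trans
      ((ConvIn.of_conv hB h₃ (.refl _)).mono fun x hx => hsq.trans (Or.inl hx))))

theorem Decreasing.convIn_of_step {R : Set (TPair L V)} (hR : Decreasing B C R) (hA : R ⊆ A)
    {s t : L.Term V} (h : Step R s t) : ConvIn (Ge B C s) A s t :=
  .of_step (h.mono hA) (.refl _) (Or.inr (hR.step h))

/-- The terms occurring in a rewrite sequence modulo `B` are below its first term. -/
theorem ConvIn.of_steps {R : Set (TPair L V)} (hR : Decreasing B C R) (hA : R ∪ B ⊆ A)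
    {s t : L.Term V} (h : Relation.ReflTransGen (StepMod B R) s t) :
    ConvIn (Ge B C s) A s t :=
  .of_steps_of hR (Set.subset_union_right.trans hA)
    (fun _ _ _ h => hR.convIn_of_step (Set.subset_union_left.trans hA) h) h

/-- Conversions stay available, below the same terms, if every equation is replaced by a conversion
through terms below one of its sides. -/
theorem ConvIn.transfer
    (H : ∀ q ∈ A, ConvIn (fun x => Ge B C q.1 x ∨ Ge B C q.2 x) A' q.1 q.2)
    (hX : ∀ a b, X a → Ge B C a b → X b) {a b : L.Term V} (h : ConvIn X A a b) :
    ConvIn X A' a b := by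
  have key : ∀ a b, X a → X b → Step A a b → ConvIn X A' a b := by
    rintro _ _ ha hb ⟨q, hq, D, σ, rfl, rfl⟩
    refine (H q hq).instantiate D σ fun x hx => ?_
    rcases hx with hx | hx
    · exact hX _ _ ha ((hx.subst σ).fill D)
    · exact hX _ _ hb ((hx.subst σ).fill D)
  induction h with
  | refl => exact .refl _
  | tail _ h ih =>
    exact ih.trans (h.2.2.elim (key _ _ h.1 h.2.1) fun h' => (key _ _ h.2.1 h.1 h').symm)

/-! ### The Church–Rosser criterion by local peaks and cliffs -/

theorem exists_normalForm {R : Set (TPair L V)} (hC : TerminatingMod B C)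
    (hR : Decreasing B C R) (s : L.Term V) :
    ∃ n, Relation.ReflTransGen (Step R) s n ∧ NF R n := by
  induction s using (Gt.wellFounded hC).induction with
  | _ s ih =>
    by_cases h : NF R s
    · exact ⟨s, .refl, h⟩
    · simp only [NF, not_forall, not_not] at h
      obtain ⟨t, ht⟩ := h
      obtain ⟨n, h₁, h₂⟩ := ih t (hR.step ht)
      exact ⟨n, .head ht h₁, h₂⟩

theorem Conv.symm_steps {s t : L.Term V} (h : Conv B s t) :
    Relation.ReflTransGen (Step (LLAC.symm B)) s t := by
  induction h with
  | rel x y h => exact .single (step_symm.2 (Or.inl h))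
  | refl x => exact .refl
  | symm x y _ ih =>
    have hsymm : Std.Symm (Step (LLAC.symm B)) := ⟨fun a b h => step_symm.2 (step_symm.1 h).symm⟩
    exact Relation.ReflTransGen.stdSymm.symm _ _ ih
  | trans x y z _ _ h₁ h₂ => exact h₁.trans h₂

/-- Any two normal forms of `B`-equivalent terms are `B`-equivalent, provided that the two sides of
each local peak are connected below its source and that each local cliff `t ← s ↔ u` can be
continued by a step `u → w` such that `t` and `w` are connected below `s`. -/
theorem normalForms_equivalent {R : Set (TPair L V)} (hC : TerminatingMod B C)
    (hR : Decreasing B C R)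
    (peak : ∀ s t u, Step R s t → Step R s u → ConvIn (Gt B C s) (R ∪ B) t u)
    (cliff : ∀ s t u, Step R s t → Step (symm B) s u →
      ∃ w, Step R u w ∧ ConvIn (Gt B C s) (R ∪ B) t w) (s : L.Term V) :
    ∀ s' n n', Conv B s s' → Relation.ReflTransGen (Step R) s n → NF R n →
      Relation.ReflTransGen (Step R) s' n' → NF R n' → Conv B n n' := by
  induction s using (Gt.wellFounded hC).induction with
  | _ s ih =>
    have chain : ∀ a b, ConvIn (Gt B C s) (R ∪ B) a b → Gt B C s a → ∀ n n',
        Relation.ReflTransGen (Step R) a n → NF R n →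
        Relation.ReflTransGen (Step R) b n' → NF R n' → Conv B n n' := by
      intro a b h ha
      induction h with
      | refl => exact fun n n' h₁ h₂ h₃ h₄ => ih a ha a n n' (.refl _) h₁ h₂ h₃ h₄
      | @tail c b _ hcb ihc =>
        intro n n' h₁ h₂ h₃ h₄
        obtain ⟨m, h₅, h₆⟩ := exists_normalForm hC hR c
        refine (ihc n m h₁ h₂ h₅ h₆).trans ?_
        obtain ⟨hc, hb, hcb⟩ := hcb
        rcases hcb with hcb | hcb <;> rcases step_union.1 hcb with hcb | hcb
        · exact ih c hc c m n' (.refl _) h₅ h₆ (.head hcb h₃) h₄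
        · exact ih c hc b m n' (.of_step hcb) h₅ h₆ h₃ h₄
        · exact ih b hb b m n' (.refl _) (.head hcb h₅) h₆ h₃ h₄
        · exact ih c hc b m n' (Conv.of_step hcb).symm h₅ h₆ h₃ h₄
    have transport : ∀ s₁, Conv B s s₁ → ∀ a b, ConvIn (Gt B C s₁) (R ∪ B) a b →
        ConvIn (Gt B C s) (R ∪ B) a b := fun s₁ h a b h' =>
      h'.mono fun x hx => hx.of_conv_left h
    have uniq : ∀ s₁, Conv B s s₁ → ∀ n n', Relation.ReflTransGen (Step R) s₁ n → NF R n →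
        Relation.ReflTransGen (Step R) s₁ n' → NF R n' → Conv B n n' := by
      intro s₁ hs n n' h₁ h₂ h₃ h₄
      rcases Relation.ReflTransGen.cases_head h₁ with rfl | ⟨t, ht, h₁⟩
      · rcases Relation.ReflTransGen.cases_head h₃ with rfl | ⟨u, hu, -⟩
        · exact .refl _
        · exact absurd hu (h₂ u)
      · rcases Relation.ReflTransGen.cases_head h₃ with rfl | ⟨u, hu, h₃⟩
        · exact absurd ht (h₄ t)
        · exact chain t u (transport s₁ hs _ _ (peak s₁ t u ht hu))
            ((hR.step ht).of_conv_left hs) n n' h₁ h₂ h₃ h₄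
    have half : ∀ s₁ u, Conv B s s₁ → Step (symm B) s₁ u → ∀ n n' t, Step R s₁ t →
        Relation.ReflTransGen (Step R) t n → NF R n →
        Relation.ReflTransGen (Step R) u n' → NF R n' → Conv B n n' := by
      intro s₁ u hs hu n n' t ht h₁ h₂ h₃ h₄
      obtain ⟨w, hw, htw⟩ := cliff s₁ t u ht hu
      obtain ⟨m, h₅, h₆⟩ := exists_normalForm hC hR w
      exact (chain t w (transport s₁ hs _ _ htw) ((hR.step ht).of_conv_left hs) n m h₁ h₂ h₅
        h₆).trans (uniq u (hs.trans (.of_symm_step hu)) m n' (.head hw h₅) h₆ h₃ h₄)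
    have single : ∀ s₁ u, Conv B s s₁ → Step (symm B) s₁ u → ∀ n n',
        Relation.ReflTransGen (Step R) s₁ n → NF R n →
        Relation.ReflTransGen (Step R) u n' → NF R n' → Conv B n n' := by
      intro s₁ u hs hu n n' h₁ h₂ h₃ h₄
      rcases Relation.ReflTransGen.cases_head h₁ with rfl | ⟨t, ht, h₁⟩
      · rcases Relation.ReflTransGen.cases_head h₃ with rfl | ⟨t, ht, h₃⟩
        · exact .of_symm_step hu
        · exact (half u s₁ (hs.trans (.of_symm_step hu)) (step_symm.2 (step_symm.1 hu).symm) n' s₁ t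
            ht h₃ h₄ .refl h₂).symm
      · exact half s₁ u hs hu n n' t ht h₁ h₂ h₃ h₄
    intro s' n n' hs
    have hs' := hs.symm_steps
    induction hs' generalizing n n' with
    | refl => exact fun h₁ h₂ h₃ h₄ => uniq s (.refl _) n n' h₁ h₂ h₃ h₄
    | @tail c d hsc hcd ihc =>
      intro h₁ h₂ h₃ h₄
      obtain ⟨m, h₅, h₆⟩ := exists_normalForm hC hR c
      have hc : Conv B s c := hs.trans (Conv.of_symm_step hcd).symm
      exact (ihc n m hc h₁ h₂ h₅ h₆).trans (single c d hc hcd m n' h₅ h₆ h₃ h₄)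

theorem churchRosserMod_of_peaks_cliffs {R : Set (TPair L V)} (hC : TerminatingMod B C)
    (hR : Decreasing B C R)
    (peak : ∀ s t u, Step R s t → Step R s u → ConvIn (Gt B C s) (R ∪ B) t u)
    (cliff : ∀ s t u, Step R s t → Step (symm B) s u →
      ∃ w, Step R u w ∧ ConvIn (Gt B C s) (R ∪ B) t w) : ChurchRosserMod B R := by
  have nfe := normalForms_equivalent hC hR peak cliff
  have key : ∀ s t, Relation.EqvGen (fun a b => Step R a b ∨ Conv B a b) s t → ∀ n n',
      Relation.ReflTransGen (Step R) s n → NF R n →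
      Relation.ReflTransGen (Step R) t n' → NF R n' → Conv B n n' := by
    intro s t h
    induction h with
    | rel x y h =>
      intro n n' h₁ h₂ h₃ h₄
      rcases h with h | h
      · exact nfe x x n n' (.refl _) h₁ h₂ (.head h h₃) h₄
      · exact nfe x y n n' h h₁ h₂ h₃ h₄
    | refl x => exact fun n n' => nfe x x n n' (.refl _)
    | symm x y _ ih => exact fun n n' h₁ h₂ h₃ h₄ => (ih n' n h₃ h₄ h₁ h₂).symm
    | trans x y z _ _ ih₁ ih₂ =>
      intro n n' h₁ h₂ h₃ h₄
      obtain ⟨m, h₅, h₆⟩ := exists_normalForm hC hR y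
      exact (ih₁ n m h₁ h₂ h₅ h₆).trans (ih₂ m n' h₅ h₆ h₃ h₄)
  intro s t h
  obtain ⟨n, h₁, h₂⟩ := exists_normalForm hC hR s
  obtain ⟨n', h₃, h₄⟩ := exists_normalForm hC hR t
  exact ⟨n, n', h₁, key s t h n n' h₁ h₂ h₃ h₄, h₃⟩

/-- For a complete system, normal forms are irreducible modulo `B`. -/
theorem CompleteMod.not_stepMod_of_nf {R : Set (TPair L V)} (h : CompleteMod B R) {t : L.Term V}
    (ht : NF R t) (u : L.Term V) : ¬ StepMod B R t u := by
  rintro ⟨a, b, h₁, h₂, -⟩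
  obtain ⟨t', b', h₃, h₄, h₅⟩ := h.2 t b
    (.trans _ _ _ (.rel _ _ (Or.inr h₁)) (.rel _ _ (Or.inl h₂)))
  rcases Relation.ReflTransGen.cases_head h₃ with rfl | ⟨c, hc, -⟩
  · -- `t ∼ a → b →* b' ∼ t` is a cycle.
    have hdec : Decreasing B R R := fun q hq => .single (.of_step (.of_mem hq))
    have hbb : Ge B R b b' := hdec.steps (reflTransGen_map id (fun _ _ => .of_step) h₅)
    exact Gt.irrefl h.1 t
      (((hdec.step h₂).of_conv_left h₁).ge_right (hbb.trans (Or.inl h₄.symm)))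
  · exact ht c hc

end Orders

/-! ### Unification of linear terms without common variables -/

section Unification

variable {L : FirstOrder.Language.{u, v}} {V : Type w}

/-- Outside `A`, the substitution `σ` takes linear values with pairwise disjoint variables. -/
def LinearOutside (A : Set V) (σ : V → L.Term V) : Prop :=
  (∀ x, x ∉ A → Linear (σ x)) ∧
    ∀ x y, x ∉ A → y ∉ A → x ≠ y → Disjoint (vars (σ x)) (vars (σ y))

theorem LinearOutside.linear_subst {A : Set V} {σ : V → L.Term V} (h : LinearOutside A σ)
    {t : L.Term V} (ht : Linear t) (hd : Disjoint (vars t) A) : Linear (t.subst σ) := by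
  induction t with
  | var x => exact h.1 x (by simpa using hd)
  | func f ts ih =>
    simp only [subst_func, linear_func, vars_func, Set.disjoint_iUnion_left] at ht hd ⊢
    refine ⟨fun i => ih i (ht.1 i) (hd i), fun i j hij => ?_⟩
    rw [vars_subst, vars_subst]
    simp only [Set.disjoint_iUnion_left, Set.disjoint_iUnion_right]
    intro y hy x hx
    refine h.2 x y (Set.disjoint_left.1 (hd i) hx) (Set.disjoint_left.1 (hd j) hy) ?_
    rintro rfl
    exact Set.disjoint_left.1 (ht.2 i j hij) hx hy

/-- An idempotent most general unifier of two linear terms without common variables. The variables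
of each of the two terms only receive subterms of the other one, hence `μ` is linear outside the
variables of either term. -/
structure IsLinearUnifier (μ : V → L.Term V) (s t : L.Term V) : Prop where
  unifies : s.subst μ = t.subst μ
  universal : ∀ τ : V → L.Term V, s.subst τ = t.subst τ → ∀ x, (μ x).subst τ = τ x
  range : ∀ x ∈ vars s ∪ vars t, vars (μ x) ⊆ vars s ∪ vars t
  outside_left : LinearOutside (vars s) μ
  outside_right : LinearOutside (vars t) μ

theorem IsLinearUnifier.swap {μ : V → L.Term V} {s t : L.Term V} (h : IsLinearUnifier μ s t) :
    IsLinearUnifier μ t s where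
  unifies := h.unifies.symm
  universal τ hτ := h.universal τ hτ.symm
  range := by simpa [Set.union_comm] using h.range
  outside_left := h.outside_right
  outside_right := h.outside_left

theorem IsLinearUnifier.isMGU {μ : V → L.Term V} {s t : L.Term V} (h : IsLinearUnifier μ s t) :
    IsMGU μ s t :=
  ⟨h.unifies, fun τ hτ => ⟨τ, fun x => (h.universal τ hτ x).symm⟩⟩

open Classical in
theorem isLinearUnifier_update {z : V} {t : L.Term V} (ht : Linear t) (hz : z ∉ vars t) :
    IsLinearUnifier (Function.update Term.var z t) (.var z) t := by
  have hne : ∀ x, x ≠ z → Function.update Term.var z t x = .var x := fun x hx => by simp [hx]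
  refine ⟨?_, ?_, ?_, ?_, ?_⟩
  · rw [subst_var, Function.update_self]
    conv_lhs => rw [← subst_var_self t]
    rw [subst_eq_subst_iff]
    intro x hx
    rw [hne x (fun e => hz (e ▸ hx))]
  · intro τ hτ x
    by_cases hx : x = z
    · subst hx; simpa using hτ.symm
    · simp [hx]
  · intro x hx
    by_cases hxz : x = z
    · subst hxz; simp
    · rw [hne x hxz]
      simpa using hx
  · constructor
    · intro x hx
      rw [hne x (by simpa using hx)]; simp
    · intro x y hx hy hxy
      rw [hne x (by simpa using hx), hne y (by simpa using hy)]
      simpa using hxy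
  · constructor
    · intro x hx
      by_cases hxz : x = z
      · subst hxz; simpa using ht
      · rw [hne x hxz]; simp
    · intro x y hx hy hxy
      by_cases hxz : x = z
      · subst hxz
        rw [hne y hxy.symm]
        simpa using hy
      · by_cases hyz : y = z
        · subst hyz
          rw [hne x hxz]
          simpa using hx
        · rw [hne x hxz, hne y hyz]
          simpa using hxy

theorem exists_isLinearUnifier {s t : L.Term V} (hs : Linear s) (ht : Linear t)
    (hd : Disjoint (vars s) (vars t)) {σ : V → L.Term V} (hσ : s.subst σ = t.subst σ) :
    ∃ μ, IsLinearUnifier μ s t := by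
  classical
  induction s generalizing t with
  | var z => exact ⟨_, isLinearUnifier_update ht (by simpa using hd)⟩
  | @func n f ts ih =>
    cases t with
    | var z => exact ⟨_, (isLinearUnifier_update hs (by simpa using hd)).swap⟩
    | @func m g us =>
      simp only [subst_func, Term.func.injEq] at hσ
      obtain ⟨rfl, hfg, hσ⟩ := hσ
      obtain rfl := eq_of_heq hfg
      replace hσ := congrFun (eq_of_heq hσ)
      simp only [linear_func] at hs ht
      simp only [vars_func, Set.disjoint_iUnion_left, Set.disjoint_iUnion_right] at hd
      choose μs hμs using fun i => ih i (hs.1 i) (ht.1 i) (hd i i) (hσ i)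
      let W : Fin n → Set V := fun i => vars (ts i) ∪ vars (us i)
      have hW : ∀ i j, i ≠ j → Disjoint (W i) (W j) := fun i j hij => by
        simp only [W, Set.disjoint_union_left, Set.disjoint_union_right]
        exact ⟨⟨hs.2 i j hij, (hd i j).symm⟩, ⟨hd j i, ht.2 i j hij⟩⟩
      let μ : V → L.Term V := fun x => if h : ∃ i, x ∈ W i then μs h.choose x else .var x
      have hμ : ∀ i x, x ∈ W i → μ x = μs i x := by
        intro i x hx
        have h : ∃ i, x ∈ W i := ⟨i, hx⟩
        have hc : h.choose = i := by
          by_contra hne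
          exact Set.disjoint_left.1 (hW _ _ hne) h.choose_spec hx
        simp only [μ, dif_pos h, hc]
      have hμ' : ∀ x, (∀ i, x ∉ W i) → μ x = .var x := by
        intro x hx
        simp only [μ]
        rw [dif_neg]
        rintro ⟨i, hi⟩
        exact hx i hi
      have hrange : ∀ i, ∀ x ∈ W i, vars (μ x) ⊆ W i := fun i x hx => by
        rw [hμ i x hx]; exact (hμs i).range x hx
      -- Linearity outside a union of sets of variables can be checked per argument.
      have hout : ∀ A : Fin n → Set V, (∀ i, LinearOutside (A i) (μs i)) →
          LinearOutside (⋃ i, A i) μ := by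
        intro A hA
        constructor
        · intro x hx
          simp only [Set.mem_iUnion, not_exists] at hx
          by_cases h : ∃ i, x ∈ W i
          · obtain ⟨i, hi⟩ := h
            rw [hμ i x hi]; exact (hA i).1 x (hx i)
          · rw [hμ' x (not_exists.1 h)]; simp
        · intro x y hx hy hxy
          simp only [Set.mem_iUnion, not_exists] at hx hy
          by_cases h : ∃ i, x ∈ W i
          · obtain ⟨i, hi⟩ := h
            by_cases h' : ∃ j, y ∈ W j
            · obtain ⟨j, hj⟩ := h'
              by_cases hij : i = j
              · subst hij
                rw [hμ i x hi, hμ i y hj]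
                exact (hA i).2 x y (hx i) (hy i) hxy
              · exact (hW i j hij).mono (hrange i x hi) (hrange j y hj)
            · rw [hμ' y (not_exists.1 h'), vars_var, Set.disjoint_singleton_right]
              exact fun hyx => h' ⟨i, hrange i x hi hyx⟩
          · rw [hμ' x (not_exists.1 h), vars_var, Set.disjoint_singleton_left]
            by_cases h' : ∃ j, y ∈ W j
            · obtain ⟨j, hj⟩ := h'
              exact fun hxy => h ⟨j, hrange j y hj hxy⟩
            · rw [hμ' y (not_exists.1 h')]; simpa using hxy
      have hsubst : ∀ i, ∀ r : L.Term V, vars r ⊆ W i → r.subst μ = r.subst (μs i) :=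
        fun i r hr => (subst_eq_subst_iff _ _ _).2 fun x hx => hμ i x (hr hx)
      refine ⟨μ, ?_, ?_, ?_, ?_, ?_⟩
      · simp only [subst_func, Term.func.injEq, heq_eq_eq, true_and]
        funext i
        rw [hsubst i _ Set.subset_union_left, hsubst i _ Set.subset_union_right]
        exact (hμs i).unifies
      · intro τ hτ x
        simp only [subst_func, Term.func.injEq, heq_eq_eq, true_and] at hτ
        by_cases h : ∃ i, x ∈ W i
        · obtain ⟨i, hi⟩ := h
          rw [hμ i x hi]
          exact (hμs i).universal τ (congrFun hτ i) x
        · rw [hμ' x (not_exists.1 h), subst_var]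
      · intro x hx
        have hWs : ∀ i, W i ⊆ vars (Term.func f ts) ∪ vars (Term.func f us) := fun i => by
          simp only [vars_func]
          exact Set.union_subset_union (Set.subset_iUnion (fun i => vars (ts i)) i)
            (Set.subset_iUnion (fun i => vars (us i)) i)
        obtain ⟨i, hi⟩ : ∃ i, x ∈ W i := by
          simp only [vars_func, Set.mem_union, Set.mem_iUnion] at hx
          rcases hx with ⟨i, hi⟩ | ⟨i, hi⟩
          · exact ⟨i, Or.inl hi⟩
          · exact ⟨i, Or.inr hi⟩
        exact (hrange i x hi).trans (hWs i)
      · rw [vars_func]; exact hout _ fun i => (hμs i).outside_left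
      · rw [vars_func]; exact hout _ fun i => (hμs i).outside_right

theorem linear_of_linear_subst {t : L.Term V} {σ : V → L.Term V}
    (hσ : ∀ x ∈ vars t, (vars (σ x)).Nonempty) (h : Linear (t.subst σ)) : Linear t := by
  induction t with
  | var x => simp
  | func f ts ih =>
    simp only [subst_func, linear_func, vars_func, Set.mem_iUnion, forall_exists_index] at h hσ ⊢
    refine ⟨fun i => ih i (fun x hx => hσ x i hx) (h.1 i), fun i j hij => ?_⟩
    rw [Set.disjoint_left]
    intro x hi hj
    obtain ⟨y, hy⟩ := hσ x i hi
    have hyi : y ∈ vars ((ts i).subst σ) := by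
      rw [vars_subst]; exact Set.mem_biUnion hi hy
    have hyj : y ∈ vars ((ts j).subst σ) := by
      rw [vars_subst]; exact Set.mem_biUnion hj hy
    exact Set.disjoint_left.1 (h.2 i j hij) hyi hyj

/-- Linearity outside a set is inherited by substitutions that are more general, provided that the
instantiation can be undone. -/
theorem LinearOutside.of_renaming {A : Set V} {μ ν : V → L.Term V} (h : LinearOutside A μ)
    {δ δ' : V → L.Term V} (hμ : ∀ x, μ x = (ν x).subst δ') (hν : ∀ x, ν x = (μ x).subst δ) :
    LinearOutside A ν := by
  have hne : ∀ x, ∀ y ∈ vars (ν x), (vars (δ' y)).Nonempty := by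
    intro x y hy
    have h₁ : (ν x).subst (fun z => (δ' z).subst δ) = (ν x).subst Term.var := by
      rw [← subst_subst, ← hμ, ← hν, subst_var_self]
    have h₂ := (subst_eq_subst_iff _ _ _).1 h₁ y hy
    have h₃ : y ∈ vars ((δ' y).subst δ) := by rw [h₂]; simp
    rw [vars_subst] at h₃
    obtain ⟨z, hz, -⟩ := by simpa using h₃
    exact ⟨z, hz⟩
  constructor
  · intro x hx
    refine linear_of_linear_subst (hne x) ?_
    rw [← hμ]; exact h.1 x hx
  · intro x y hx hy hxy
    rw [Set.disjoint_left]
    intro z hzx hzy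
    obtain ⟨a, ha⟩ := hne x z hzx
    have h₁ : a ∈ vars (μ x) := by rw [hμ, vars_subst]; exact Set.mem_biUnion hzx ha
    have h₂ : a ∈ vars (μ y) := by rw [hμ, vars_subst]; exact Set.mem_biUnion hzy ha
    exact Set.disjoint_left.1 (h.2 x y hx hy hxy) h₁ h₂

theorem IsMGU.linearOutside {s t : L.Term V} (hs : Linear s) (ht : Linear t)
    (hd : Disjoint (vars s) (vars t)) {ν : V → L.Term V} (hν : IsMGU ν s t) :
    LinearOutside (vars s) ν ∧ LinearOutside (vars t) ν := by
  obtain ⟨μ, hμ⟩ := exists_isLinearUnifier hs ht hd hν.1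
  obtain ⟨δ', hδ'⟩ := hν.2 μ hμ.unifies
  have hδ : ∀ x, ν x = (μ x).subst ν := fun x => (hμ.universal ν hν.1 x).symm
  exact ⟨hμ.outside_left.of_renaming hδ' hδ, hμ.outside_right.of_renaming hδ' hδ⟩

/-! ### Critical peaks of left-linear systems -/

theorem exists_perm_image_disjoint [Infinite V] {F G : Set V} (hF : F.Finite) (hG : G.Finite) :
    ∃ π : Equiv.Perm V, Disjoint (π '' F) G := by
  classical
  induction F, hF using Set.Finite.induction_on with
  | empty => exact ⟨1, by simp⟩
  | @insert x F hx hF ih =>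
    obtain ⟨π, hπ⟩ := ih
    obtain ⟨z, hz⟩ := ((((hF.image π).insert (π x)).union hG)).infinite_compl.nonempty
    simp only [Set.mem_compl_iff, Set.mem_union, Set.mem_insert_iff, not_or] at hz
    refine ⟨π.trans (Equiv.swap (π x) z), ?_⟩
    rw [Set.disjoint_left] at hπ ⊢
    rintro _ ⟨y, hy | hy, rfl⟩
    · subst hy
      simpa using hz.2
    · have h₁ : π y ≠ π x := fun e => hx (π.injective e ▸ hy)
      have h₂ : π y ≠ z := fun e => hz.1.2 ⟨y, hy, e⟩
      rw [Equiv.trans_apply, Equiv.swap_apply_of_ne_of_ne h₁ h₂]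
      exact hπ ⟨y, hy, rfl⟩

theorem Variant.refl (q : TPair L V) : Variant q q :=
  ⟨1, Prod.ext (FirstOrder.Language.Term.relabel_id _).symm
    (FirstOrder.Language.Term.relabel_id _).symm⟩

theorem Variant.symm {q q' : TPair L V} (h : Variant q q') : Variant q' q := by
  obtain ⟨π, rfl⟩ := h
  refine ⟨π.symm, ?_⟩
  simp only [FirstOrder.Language.Term.relabel_relabel, Equiv.symm_comp_self,
    FirstOrder.Language.Term.relabel_id]

theorem Variant.trans {q q' q'' : TPair L V} (h : Variant q q') (h' : Variant q' q'') :
    Variant q q'' := by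
  obtain ⟨π, rfl⟩ := h
  obtain ⟨π', rfl⟩ := h'
  exact ⟨π.trans π', by simp⟩

theorem Variant.step {q q' : TPair L V} (h : Variant q q') : Step {q} q'.1 q'.2 := by
  obtain ⟨π, rfl⟩ := h
  exact ⟨q, rfl, .hole, fun x => .var (π x), by simp [relabel_eq_subst],
    by simp [relabel_eq_subst]⟩

theorem Variant.isRule {q q' : TPair L V} (h : Variant q q') (hq : IsRule q) : IsRule q' := by
  obtain ⟨π, rfl⟩ := h
  refine ⟨fun x => ?_, ?_⟩
  · have := hq.1
    cases hq1 : q.1 with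
    | var y => exact absurd hq1 (this y)
    | func f ts => simp
  · rw [vars_relabel, vars_relabel]
    exact Set.image_mono hq.2

theorem Variant.linear {q q' : TPair L V} (h : Variant q q') (hq : Linear q.1) :
    Linear q'.1 := by
  obtain ⟨π, rfl⟩ := h
  exact linear_relabel hq π

/-- Variant rules applied at the root of a term give the same result. -/
theorem Variant.subst_eq {q q' : TPair L V} (h : Variant q q') (hq : IsRule q)
    {σ τ : V → L.Term V} (he : q.1.subst σ = q'.1.subst τ) : q.2.subst σ = q'.2.subst τ := by
  obtain ⟨π, rfl⟩ := h
  simp only [relabel_eq_subst, subst_subst] at he ⊢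
  rw [subst_eq_subst_iff] at he ⊢
  exact fun x hx => he x (hq.2 hx)

/-- Every overlap of two left-linear rules is an instance of a critical peak, unless the rules are
variants applied at the same position. -/
theorem exists_critPeak [Infinite V] {R₁ R₂ : Set (TPair L V)} {q₁ q₂ : TPair L V}
    (h₁ : q₁ ∈ R₁) (h₂ : q₂ ∈ R₂) (hr₁ : IsRule q₁) (hr₂ : IsRule q₂) (hl₁ : Linear q₁.1)
    (hl₂ : Linear q₂.1) {D : Ctx L V} {b : L.Term V} {σ τ : V → L.Term V}
    (hD : q₂.1 = D.fill b) (hb : ∀ x, b ≠ .var x) (hσ : b.subst τ = q₁.1.subst σ) :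
    (D = .hole ∧ Variant q₁ q₂) ∨ ∃ t a s u δ, CritPeak R₁ R₂ t a s u ∧
      a.subst δ = q₁.1.subst σ ∧ s.subst δ = q₂.1.subst τ ∧
      t.subst δ = (D.subst τ).fill (q₁.2.subst σ) ∧ u.subst δ = q₂.2.subst τ := by
  classical
  obtain ⟨π, hπ⟩ := exists_perm_image_disjoint (vars_finite q₁.1) (vars_finite q₂.1)
  rw [← vars_relabel] at hπ
  set ρ : TPair L V := (q₁.1.relabel π, q₁.2.relabel π) with hρ
  have hv : Variant q₁ ρ := ⟨π, rfl⟩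
  by_cases htriv : D = .hole ∧ Variant ρ q₂
  · exact Or.inl ⟨htriv.1, hv.trans htriv.2⟩
  have hrρ := hv.isRule hr₁
  let θ : V → L.Term V := fun x => if x ∈ vars ρ.1 then σ (π.symm x) else τ x
  have hθ₁ : ∀ r : L.Term V, vars (r.relabel π) ⊆ vars ρ.1 →
      (r.relabel π).subst θ = r.subst σ := by
    intro r hr
    have : r.subst σ = (r.relabel π).subst (fun x => σ (π.symm x)) := by
      rw [relabel_eq_subst, subst_subst]; simp
    rw [this, subst_eq_subst_iff]
    intro x hx
    simp only [θ, if_pos (hr hx)]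
  have hθ₂ : ∀ x ∈ vars q₂.1, θ x = τ x := fun x hx => by
    simp only [θ]; rw [if_neg (Set.disjoint_right.1 hπ hx)]
  have hvb : vars b ⊆ vars q₂.1 := hD ▸ vars_fill_hole_subset D b
  have hub : ρ.1.subst θ = b.subst θ := by
    rw [hθ₁ q₁.1 subset_rfl, ← hσ, subst_eq_subst_iff]
    exact fun x hx => (hθ₂ x (hvb hx)).symm
  obtain ⟨μ, hμ⟩ := exists_isLinearUnifier (hv.linear hl₁)
    (linear_of_linear_fill (hD ▸ hl₂)) (hπ.mono_right hvb) hub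
  have hμθ : ∀ r : L.Term V, (r.subst μ).subst θ = r.subst θ := by
    intro r
    rw [subst_subst, subst_eq_subst_iff]
    exact fun x _ => hμ.universal θ hub x
  refine Or.inr ⟨_, _, _, _, θ, ⟨ρ, q₂, ⟨q₁, h₁, hv⟩, ⟨q₂, h₂, .refl _⟩, ?_, D, b, μ, hD, hb,
    hμ.isMGU, fun h h' => htriv ⟨h, h'⟩, rfl, rfl, rfl, rfl⟩, ?_, ?_, ?_, ?_⟩
  · rw [Set.union_eq_self_of_subset_right hrρ.2, Set.union_eq_self_of_subset_right hr₂.2]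
    exact hπ
  · rw [hμθ, hθ₁ q₁.1 subset_rfl]
  · rw [hμθ, subst_eq_subst_iff]; exact hθ₂
  · rw [fill_subst, ctx_subst_subst, hμθ, hθ₁ q₁.2 hrρ.2]
    refine fill_subst_congr (b := b) (fun x hx => ?_) _
    rw [hμ.universal θ hub, hθ₂ x (hD ▸ hx)]
  · rw [hμθ, subst_eq_subst_iff]; exact fun x hx => hθ₂ x (hr₂.2 hx)

/-- In a critical peak `t ← s → u` both sides arise by rewrite steps from `s`. -/
theorem CritPeak.steps {R₁ R₂ : Set (TPair L V)} {t a s u : L.Term V}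
    (h : CritPeak R₁ R₂ t a s u) : Step R₁ s t ∧ Step R₂ s u := by
  obtain ⟨ρ₁, ρ₂, ⟨q₁, h₁, hv₁⟩, ⟨q₂, h₂, hv₂⟩, -, C, b, σ, hC, -, hσ, -, rfl, rfl, rfl, rfl⟩ := h
  constructor
  · have := ((hv₁.step.mono (Set.singleton_subset_iff.2 h₁)).subst σ).fill (C.subst σ)
    rwa [hσ.1, ← fill_subst, ← hC] at this
  · exact (hv₂.step.mono (Set.singleton_subset_iff.2 h₂)).subst σ

/-- If the rules are left-linear and both sides of the root rule of a critical peak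
`t ← s → u` are linear, then `u` is linear. -/
theorem CritPeak.linear_root {R₁ R₂ : Set (TPair L V)} {t a s u : L.Term V}
    (h : CritPeak R₁ R₂ t a s u) (hl₁ : ∀ q ∈ R₁, Linear q.1)
    (hl₂ : ∀ q ∈ R₂, Linear q.1 ∧ Linear q.2) : Linear u := by
  obtain ⟨ρ₁, ρ₂, ⟨q₁, h₁, hv₁⟩, ⟨q₂, h₂, hv₂⟩, hd, C, b, σ, hC, -, hσ, -, rfl, rfl, rfl, rfl⟩ := h
  have hρ₂ : Linear ρ₂.1 ∧ Linear ρ₂.2 := by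
    obtain ⟨π, rfl⟩ := hv₂
    exact ⟨linear_relabel (hl₂ _ h₂).1 π, linear_relabel (hl₂ _ h₂).2 π⟩
  have hvb : vars b ⊆ vars ρ₂.1 := hC ▸ vars_fill_hole_subset C b
  have hd₁ : Disjoint (vars ρ₁.1) (vars ρ₂.1 ∪ vars ρ₂.2) := hd.mono_left Set.subset_union_left
  have hout := (hσ.linearOutside (hv₁.linear (hl₁ _ h₁)) (linear_of_linear_fill (hC ▸ hρ₂.1))
    (hd₁.mono_right (hvb.trans Set.subset_union_left))).1
  exact hout.linear_subst hρ₂.2 (hd₁.mono_right Set.subset_union_right).symm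

/-- If the rules are left-linear and both sides of the inner rule of a critical peak
`t ← s → u` are linear, then `t` is linear. -/
theorem CritPeak.linear_inner {R₁ R₂ : Set (TPair L V)} {t a s u : L.Term V}
    (h : CritPeak R₁ R₂ t a s u) (hl₁ : ∀ q ∈ R₁, Linear q.1 ∧ Linear q.2)
    (hl₂ : ∀ q ∈ R₂, Linear q.1) : Linear t := by
  obtain ⟨ρ₁, ρ₂, ⟨q₁, h₁, hv₁⟩, ⟨q₂, h₂, hv₂⟩, hd, C, b, σ, hC, -, hσ, -, rfl, rfl, rfl, rfl⟩ := h
  have hρ₁ : Linear ρ₁.1 ∧ Linear ρ₁.2 := by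
    obtain ⟨π, rfl⟩ := hv₁
    exact ⟨linear_relabel (hl₁ _ h₁).1 π, linear_relabel (hl₁ _ h₁).2 π⟩
  have hl : Linear (C.fill b) := hC ▸ hv₂.linear (hl₂ _ h₂)
  have hvb : vars b ⊆ vars ρ₂.1 := hC ▸ vars_fill_hole_subset C b
  have hd₂ : Disjoint (vars ρ₁.1 ∪ vars ρ₁.2) (vars ρ₂.1) := hd.mono_right Set.subset_union_left
  have hout := (hσ.linearOutside hρ₁.1 (linear_of_linear_fill hl)
    ((hd₂.mono_left Set.subset_union_left).mono_right hvb)).2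
  have hd₃ := hd₂.mono_left Set.subset_union_right
  rw [← fill_subst]
  refine hout.linear_subst (linear_fill hl hρ₁.2 (hC ▸ hd₃)) ?_
  rw [Set.disjoint_left]
  intro x hx hxb
  rcases vars_fill_of_linear hl hx with h | h
  · exact Set.disjoint_left.1 hd₃ h (hvb hxb)
  · exact h.2 hxb

end Unification

/-! ### From prime overlaps to local peaks and cliffs -/

section Overlaps

variable {L : FirstOrder.Language.{u, v}} {V : Type w}

/-- The equations of `B`, read in either direction, are linear rules. In particular both sides have
the same variables. -/
def LinearRegular (B : Set (TPair L V)) : Prop := ∀ e ∈ symm B, IsRule e ∧ Linear e.1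

theorem swap_mem_symm {B : Set (TPair L V)} {e : TPair L V} (he : e ∈ symm B) :
    e.swap ∈ symm B := by
  rcases he with he | ⟨e, he, rfl⟩
  · exact Or.inr ⟨e, he, rfl⟩
  · exact Or.inl he

theorem LinearRegular.linear_snd {B : Set (TPair L V)} (hB : LinearRegular B) {e : TPair L V}
    (he : e ∈ symm B) : Linear e.2 := (hB _ (swap_mem_symm he)).2

theorem LinearRegular.vars_subset {B : Set (TPair L V)} (hB : LinearRegular B) {e : TPair L V}
    (he : e ∈ symm B) : vars e.1 ⊆ vars e.2 := (hB _ (swap_mem_symm he)).1.2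

/-- All proper subterms of `a` are normal forms. -/
def ArgsNF (R : Set (TPair L V)) (a : L.Term V) : Prop := ∀ b, ProperSubterm b a → NF R b

/-- There is a peak `t ← s → u` in which `q₂` is applied at the root and `q₁` at a
non-variable position of the left-hand side of `q₂`; the redex of `q₁` has irreducible proper
subterms. -/
def PrimeOverlap (R : Set (TPair L V)) (q₁ q₂ : TPair L V) (t s u : L.Term V) : Prop :=
  ∃ (D : Ctx L V) (b : L.Term V) (σ τ : V → L.Term V), q₂.1 = D.fill b ∧ (∀ x, b ≠ .var x) ∧
    b.subst τ = q₁.1.subst σ ∧ ArgsNF R (q₁.1.subst σ) ∧ s = q₂.1.subst τ ∧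
    t = (D.subst τ).fill (q₁.2.subst σ) ∧ u = q₂.2.subst τ

/-- The peaks arising from prime overlaps of rules in `R` are connected below their source by
conversions in `A`. In a cliff `t ← s ↔ u` arising from a prime overlap of a rule in `R` with an
equation of `B`, there is a step `u → w` with `X` such that `t` and `w` are connected below `s`. -/
structure LocallyConnected (B C A X R : Set (TPair L V)) : Prop where
  peak : ∀ q₁ ∈ R, ∀ q₂ ∈ R, ∀ t s u, PrimeOverlap R q₁ q₂ t s u → ConvIn (Gt B C s) A t u
  cliff_inner : ∀ q ∈ R, ∀ e ∈ symm B, ∀ t s u, PrimeOverlap R q e t s u →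
    ∃ w, Step X u w ∧ ConvIn (Gt B C s) A t w
  cliff_root : ∀ q ∈ R, ∀ e ∈ symm B, ∀ t s u, PrimeOverlap R e q u s t →
    ∃ w, Step X u w ∧ ConvIn (Gt B C s) A t w

variable {B C A X R : Set (TPair L V)}

theorem ArgsNF.of_fill {D : Ctx L V} {a : L.Term V} (h : ArgsNF R (D.fill a)) : ArgsNF R a := by
  rintro b ⟨C, hC, rfl⟩
  exact h b ⟨D.comp C, fun e => hC (comp_eq_hole e).2, (fill_comp _ _ _).symm⟩

theorem ArgsNF.of_subst {a : L.Term V} {σ : V → L.Term V} (h : ArgsNF R (a.subst σ)) :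
    ArgsNF R a := by
  rintro b ⟨C, hC, rfl⟩
  exact (h (b.subst σ) ⟨C.subst σ, ctx_subst_ne_hole hC σ, fill_subst _ _ _⟩).of_subst

theorem ArgsNF.hole_of_step {D : Ctx L V} {a b : L.Term V} (h : ArgsNF R (D.fill a))
    (ha : Step R a b) : D = .hole := by
  by_contra hD
  exact h a ⟨D, hD, rfl⟩ b ha

/-- A reducible term contains an innermost redex. -/
theorem exists_innermost {s : L.Term V} (h : ¬ NF R s) :
    ∃ q ∈ R, ∃ (D : Ctx L V) (σ : V → L.Term V),
      s = D.fill (q.1.subst σ) ∧ ArgsNF R (q.1.subst σ) := by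
  induction s with
  | var x =>
    simp only [NF, not_forall, not_not] at h
    obtain ⟨u, q, hq, D, σ, h₁, -⟩ := h
    refine ⟨q, hq, D, σ, h₁, ?_⟩
    rintro b ⟨C, hC, hb⟩
    rw [hb, ← fill_comp] at h₁
    cases hDC : D.comp C with
    | hole => exact absurd (comp_eq_hole hDC).2 hC
    | app f i ts E => simp [hDC] at h₁
  | func f ts ih =>
    by_cases hi : ∃ i, ¬ NF R (ts i)
    · obtain ⟨i, hi⟩ := hi
      obtain ⟨q, hq, D, σ, h₁, h₂⟩ := ih i hi
      exact ⟨q, hq, .app f i ts D, σ, by simp [← h₁], h₂⟩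
    · have hi' : ∀ i, NF R (ts i) := fun i => not_not.1 (not_exists.1 hi i)
      have hargs : ∀ (C : Ctx L V) (b : L.Term V), C ≠ .hole → Term.func f ts = C.fill b →
          NF R b := by
        intro C b hC hb
        cases C with
        | hole => exact absurd rfl hC
        | @app n g i us C =>
          simp only [fill_app, Term.func.injEq] at hb
          obtain ⟨rfl, -, hb⟩ := hb
          have := congrFun (eq_of_heq hb) i
          rw [Function.update_self] at this
          exact (this ▸ hi' i : NF R (C.fill b)).of_fill
      simp only [NF, not_forall, not_not] at h
      obtain ⟨u, q, hq, D, σ, h₁, -⟩ := h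
      have hD : D = .hole := by
        by_contra hD
        exact hargs D _ hD h₁ _ ((Step.of_mem hq).subst σ)
      subst hD
      refine ⟨q, hq, .hole, σ, h₁, ?_⟩
      rintro b ⟨C, hC, hb⟩
      exact hargs C b hC (h₁.trans hb)

theorem ConvIn.gt_instantiate {s a b : L.Term V} (h : ConvIn (Gt B C s) A a b) (D : Ctx L V)
    (σ : V → L.Term V) :
    ConvIn (Gt B C (D.fill (s.subst σ))) A (D.fill (a.subst σ)) (D.fill (b.subst σ)) :=
  h.instantiate D σ fun _ hx => (hx.subst σ).fill D

theorem ConvIn.gt_fill {s a b : L.Term V} (h : ConvIn (Gt B C s) A a b) (D : Ctx L V) :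
    ConvIn (Gt B C (D.fill s)) A (D.fill a) (D.fill b) := by
  simpa only [subst_var_self] using h.gt_instantiate D Term.var

theorem PrimeOverlap.steps {q₁ q₂ : TPair L V} {t s u : L.Term V}
    (h : PrimeOverlap R q₁ q₂ t s u) : Step {q₁} s t ∧ Step {q₂} s u := by
  obtain ⟨D, b, σ, τ, hD, -, hb, -, rfl, rfl, rfl⟩ := h
  refine ⟨⟨q₁, rfl, D.subst τ, σ, ?_, rfl⟩, ⟨q₂, rfl, .hole, τ, rfl, rfl⟩⟩
  rw [hD, fill_subst, hb]

theorem subst_steps_update {x : V} {τ : V → L.Term V} {a : L.Term V} [DecidableEq V]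
    (h : Step R (τ x) a) (r : L.Term V) :
    Relation.ReflTransGen (Step R) (r.subst τ) (r.subst (Function.update τ x a)) := by
  refine subst_congr_of_compatible (fun _ => .refl) (fun h h' => h.trans h')
    (fun D h => reflTransGen_map D.fill (fun _ _ h => h.fill D) h) (fun y => ?_) r
  by_cases hy : y = x
  · subst hy; simpa using .single h
  · simpa [hy] using .refl

/-- A peak whose inner redex is innermost, the outer step being at the root. By left-linearity an
inner redex in the substitution part can be contracted after the outer step. -/
theorem nested_peak (hC : Decreasing B C R) (hl : ∀ q ∈ R, Linear q.1)
    (hlc : LocallyConnected B C (R ∪ B) R R) {q₁ q₂ : TPair L V} (h₁ : q₁ ∈ R) (h₂ : q₂ ∈ R)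
    {σ τ : V → L.Term V} {D : Ctx L V} (hD : q₂.1.subst τ = D.fill (q₁.1.subst σ))
    (hp : ArgsNF R (q₁.1.subst σ)) :
    ConvIn (Gt B C (q₂.1.subst τ)) (R ∪ B) (D.fill (q₁.2.subst σ)) (q₂.2.subst τ) := by
  classical
  rcases subst_eq_fill hD with ⟨D', b, e₁, e₂, e₃, e₄⟩ | ⟨x, D₁, D₂, e₁, e₂, e₃⟩
  · rw [e₄]
    exact hlc.peak q₁ h₁ q₂ h₂ _ _ _ ⟨D', b, σ, τ, e₁, e₂, e₃, hp, rfl, rfl, rfl⟩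
  · have hstep : Step R (τ x) (D₂.fill (q₁.2.subst σ)) := by
      rw [e₂]; exact ((Step.of_mem h₁).subst σ).fill D₂
    set τ' := Function.update τ x (D₂.fill (q₁.2.subst σ)) with hτ'
    have ht : D.fill (q₁.2.subst σ) = q₂.1.subst τ' := by
      rw [e₃, e₁, hτ', subst_update_of_linear (e₁ ▸ hl q₂ h₂)]
    have hst : Gt B C (q₂.1.subst τ) (q₂.1.subst τ') := by
      rw [← ht, hD]
      exact hC.step (((Step.of_mem h₁).subst σ).fill D)
    have hroot : ∀ τ, Step R (q₂.1.subst τ) (q₂.2.subst τ) := fun τ => (Step.of_mem h₂).subst τ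
    rw [ht]
    refine (ConvIn.of_step ((hroot τ').mono Set.subset_union_left) hst
      (hst.trans (hC.step (hroot τ')))).trans (ConvIn.symm ?_)
    refine (ConvIn.of_steps hC subset_rfl (reflTransGen_map id (fun _ _ h => .of_step h)
      (subst_steps_update hstep q₂.2))).mono fun y hy => ?_
    exact (hC.step (hroot τ)).ge_right hy

theorem peak_of_innermost (hC : Decreasing B C R) (hl : ∀ q ∈ R, Linear q.1)
    (hlc : LocallyConnected B C (R ∪ B) R R) {q : TPair L V} (hq : q ∈ R) {D : Ctx L V}
    {σ : V → L.Term V} (hp : ArgsNF R (q.1.subst σ)) {u : L.Term V}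
    (hu : Step R (D.fill (q.1.subst σ)) u) :
    ConvIn (Gt B C (D.fill (q.1.subst σ))) (R ∪ B) (D.fill (q.2.subst σ)) u := by
  obtain ⟨q₂, h₂, D₂, τ, he, rfl⟩ := hu
  have hs₁ : Step R (q.1.subst σ) (q.2.subst σ) := (Step.of_mem hq).subst σ
  have hs₂ : Step R (q₂.1.subst τ) (q₂.2.subst τ) := (Step.of_mem h₂).subst τ
  have nested : ∀ {E : Ctx L V}, q₂.1.subst τ = E.fill (q.1.subst σ) →
      (∀ x, D.fill x = D₂.fill (E.fill x)) →
      ConvIn (Gt B C (D.fill (q.1.subst σ))) (R ∪ B) (D.fill (q.2.subst σ))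
        (D₂.fill (q₂.2.subst τ)) := by
    intro E h₃ h₄
    rw [he, h₄]
    exact (nested_peak hC hl hlc hq h₂ h₃ hp).gt_fill D₂
  rcases fill_eq_fill he with ⟨E, h₃, h₄⟩ | ⟨E, h₃, h₄⟩ | ⟨F, h₃, h₄, h₅, h₆⟩
  · obtain rfl : E = .hole := ArgsNF.hole_of_step (h₃ ▸ hp) hs₂
    exact nested (E := .hole) h₃.symm fun x => (h₄ x).symm
  · exact nested h₃ h₄
  · -- Parallel redexes: both steps commute.
    have e₁ : Step R (D.fill (q.2.subst σ)) (F (q.2.subst σ) (q₂.2.subst τ)) := by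
      obtain ⟨E, hE⟩ := h₅ (q.2.subst σ)
      rw [h₃, hE, hE]; exact hs₂.fill E
    have e₂ : Step R (D₂.fill (q₂.2.subst τ)) (F (q.2.subst σ) (q₂.2.subst τ)) := by
      obtain ⟨E, hE⟩ := h₆ (q₂.2.subst τ)
      rw [h₄, hE, hE]; exact hs₁.fill E
    have g₁ := hC.step (hs₁.fill D)
    have g₂ : Gt B C (D.fill (q.1.subst σ)) (D₂.fill (q₂.2.subst τ)) := by
      rw [he]; exact hC.step (hs₂.fill D₂)
    have g₃ := g₁.trans (hC.step e₁)
    exact (ConvIn.of_step (e₁.mono Set.subset_union_left) g₁ g₃).trans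
      (ConvIn.of_step (e₂.mono Set.subset_union_left) g₂ g₃).symm

/-- Any two steps from `s` are connected below `s`: both are compared with an innermost step. -/
theorem peak_connected (hC : Decreasing B C R) (hl : ∀ q ∈ R, Linear q.1)
    (hlc : LocallyConnected B C (R ∪ B) R R) (s t u : L.Term V) (ht : Step R s t)
    (hu : Step R s u) : ConvIn (Gt B C s) (R ∪ B) t u := by
  obtain ⟨q, hq, D, σ, rfl, hp⟩ := exists_innermost fun h : NF R s => h t ht
  exact (peak_of_innermost hC hl hlc hq hp ht).symm.trans (peak_of_innermost hC hl hlc hq hp hu)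

theorem cliff_of_innermost (hB : LinearRegular B) (hC : Decreasing B C R)
    (hl : ∀ q ∈ R, Linear q.1) (hlc : LocallyConnected B C (R ∪ B) R R) {q : TPair L V}
    (hq : q ∈ R) {D : Ctx L V} {σ : V → L.Term V} (hp : ArgsNF R (q.1.subst σ)) {u : L.Term V}
    (hu : Step (symm B) (D.fill (q.1.subst σ)) u) :
    ∃ w, Step R u w ∧ ConvIn (Gt B C (D.fill (q.1.subst σ))) (R ∪ B) (D.fill (q.2.subst σ)) w := by
  classical
  obtain ⟨e, hes, D₂, τ, he, rfl⟩ := hu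
  have hs₁ : Step R (q.1.subst σ) (q.2.subst σ) := (Step.of_mem hq).subst σ
  have hs₂ : Step (symm B) (e.1.subst τ) (e.2.subst τ) := (Step.of_mem hes).subst τ
  have g₁ := hC.step (hs₁.fill D)
  have hBA : B ⊆ R ∪ B := Set.subset_union_right
  rcases fill_eq_fill he with ⟨E, h₃, h₄⟩ | ⟨E, h₃, h₄⟩ | ⟨F, h₃, h₄, h₅, h₆⟩
  · -- The equation is applied inside the redex.
    rw [h₄]
    suffices h : ∃ w, Step R (E.fill (e.2.subst τ)) w ∧
        ConvIn (Gt B C (q.1.subst σ)) (R ∪ B) (q.2.subst σ) w by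
      obtain ⟨w, hw, hw'⟩ := h
      exact ⟨D.fill w, hw.fill D, hw'.gt_fill D⟩
    rcases subst_eq_fill h₃ with ⟨D', b, e₁, e₂, e₃, e₄⟩ | ⟨x, E₁, E₂, e₁, e₂, e₃⟩
    · rw [e₄]
      exact hlc.cliff_root q hq e hes _ _ _
        ⟨D', b, τ, σ, e₁, e₂, e₃, (h₃ ▸ hp : ArgsNF R (E.fill _)).of_fill, rfl, rfl, rfl⟩
    · set σ' := Function.update σ x (E₂.fill (e.2.subst τ)) with hσ'
      have hu : E.fill (e.2.subst τ) = q.1.subst σ' := by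
        rw [e₃, e₁, hσ', subst_update_of_linear (e₁ ▸ hl q hq)]
      refine ⟨q.2.subst σ', hu ▸ (Step.of_mem hq).subst σ', ?_⟩
      refine ConvIn.of_conv_gt hBA ?_ (hC.step hs₁)
      refine subst_congr_of_compatible Conv.refl Conv.trans (fun D h => h.fill D) (fun y => ?_) q.2
      by_cases hy : y = x
      · subst hy
        rw [hσ', Function.update_self, e₂]
        exact .of_symm_step (hs₂.fill E₂)
      · rw [hσ', Function.update_of_ne hy]; exact .refl _
  · -- The redex lies inside the instance of the equation.
    suffices h : ∃ w, Step R (e.2.subst τ) w ∧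
        ConvIn (Gt B C (e.1.subst τ)) (R ∪ B) (E.fill (q.2.subst σ)) w by
      obtain ⟨w, hw, hw'⟩ := h
      refine ⟨D₂.fill w, hw.fill D₂, ?_⟩
      rw [he, h₄]
      exact hw'.gt_fill D₂
    rcases subst_eq_fill h₃ with ⟨D', b, e₁, e₂, e₃, e₄⟩ | ⟨x, E₁, E₂, e₁, e₂, e₃⟩
    · rw [e₄]
      exact hlc.cliff_inner q hq e hes _ _ _ ⟨D', b, σ, τ, e₁, e₂, e₃, hp, rfl, rfl, rfl⟩
    · set τ' := Function.update τ x (E₂.fill (q.2.subst σ)) with hτ'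
      have ht : E.fill (q.2.subst σ) = e.1.subst τ' := by
        rw [e₃, e₁, hτ', subst_update_of_linear (e₁ ▸ (hB e hes).2)]
      have hx : x ∈ vars e.2 := hB.vars_subset hes (by
        rw [e₁]; exact vars_fill_hole_subset _ _ (by simp))
      obtain ⟨G, hG⟩ := exists_fill_var_of_mem_vars hx
      refine ⟨e.2.subst τ', ?_, ?_⟩
      · -- The variable `x` occurs exactly once in the other side.
        have h₅ : e.2.subst τ' = (G.subst τ).fill (E₂.fill (q.2.subst σ)) := by
          rw [hG, hτ', subst_update_of_linear (hG ▸ hB.linear_snd hes)]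
        have h₆ : e.2.subst τ = (G.subst τ).fill (E₂.fill (q.1.subst σ)) := by
          rw [hG, fill_subst, subst_var, e₂]
        rw [h₅, h₆]
        exact (hs₁.fill E₂).fill _
      · rw [ht]
        refine ConvIn.of_conv_gt hBA (.of_symm_step ((Step.of_mem hes).subst τ')) ?_
        rw [← ht, h₃]
        exact hC.step (hs₁.fill E)
  · refine ⟨F (q.2.subst σ) (e.2.subst τ), ?_, ConvIn.of_conv_gt hBA (.of_symm_step ?_) g₁⟩
    · obtain ⟨E, hE⟩ := h₆ (e.2.subst τ)
      rw [h₄, hE, hE]; exact hs₁.fill E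
    · obtain ⟨E, hE⟩ := h₅ (q.2.subst σ)
      rw [h₃, hE, hE]; exact hs₂.fill E

theorem cliff_connected (hB : LinearRegular B) (hC : Decreasing B C R)
    (hl : ∀ q ∈ R, Linear q.1) (hlc : LocallyConnected B C (R ∪ B) R R) (s t u : L.Term V)
    (ht : Step R s t) (hu : Step (symm B) s u) :
    ∃ w, Step R u w ∧ ConvIn (Gt B C s) (R ∪ B) t w := by
  obtain ⟨q, hq, D, σ, rfl, hp⟩ := exists_innermost fun h : NF R s => h t ht
  obtain ⟨w, hw, hw'⟩ := cliff_of_innermost hB hC hl hlc hq hp hu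
  exact ⟨w, hw, (peak_of_innermost hC hl hlc hq hp ht).symm.trans hw'⟩

/-- A decreasing left-linear system whose prime overlaps are connected is Church–Rosser modulo
`B`. -/
theorem LocallyConnected.churchRosserMod (hB : LinearRegular B) (hT : TerminatingMod B C)
    (hC : Decreasing B C R) (hl : ∀ q ∈ R, Linear q.1)
    (hlc : LocallyConnected B C (R ∪ B) R R) : ChurchRosserMod B R :=
  churchRosserMod_of_peaks_cliffs hT hC (peak_connected hC hl hlc)
    (cliff_connected hB hC hl hlc)

/-! ### Preservation of local connectedness -/

/-- Local connectedness is preserved if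
* every equation is replaced by a conversion below one of its sides,
* the left-hand side of every rule of `X` can still be rewritten, to a term connected to the
  right-hand side below the left-hand side,
* the rules of `R'` are rules of `R` with right-hand sides exchanged by connected ones, and
* the left-hand sides of `R` stay reducible. -/
theorem LocallyConnected.transfer {A' X' R' : Set (TPair L V)}
    (hlc : LocallyConnected B C A X R)
    (hA : ∀ q ∈ A, ConvIn (fun x => Ge B C q.1 x ∨ Ge B C q.2 x) A' q.1 q.2)
    (hX : ∀ q ∈ X, ∃ w, Step X' q.1 w ∧ ConvIn (Gt B C q.1) A' q.2 w)
    (hR : ∀ q' ∈ R', ∃ q ∈ R, q'.1 = q.1 ∧ ConvIn (Gt B C q.1) A' q'.2 q.2)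
    (hN : ∀ q ∈ R, ¬ NF R' q.1) : LocallyConnected B C A' X' R' := by
  have down : ∀ s a b, Gt B C s a → Ge B C a b → Gt B C s b := fun s a b h h' => h.ge_right h'
  have hArgs : ∀ {a : L.Term V}, ArgsNF R' a → ArgsNF R a := fun h b hb => (h b hb).of_lhs hN
  have hstep : ∀ {s t u w : L.Term V}, Conv B s u → Step X u w → ConvIn (Gt B C s) A t w →
      ∃ w, Step X' u w ∧ ConvIn (Gt B C s) A' t w := by
    rintro s t _ _ hsu ⟨q, hq, D, σ, rfl, rfl⟩ htw
    obtain ⟨w, hw, hw'⟩ := hX q hq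
    refine ⟨_, (hw.subst σ).fill D, (ConvIn.transfer hA (down s) htw).trans
      ((hw'.gt_instantiate D σ).mono fun x hx => hx.of_conv_left hsu)⟩
  refine ⟨?_, ?_, ?_⟩
  · rintro q₁' h₁ q₂' h₂ _ _ _ ⟨D, b, σ, τ, e₁, e₂, e₃, e₄, rfl, rfl, rfl⟩
    obtain ⟨q₁, h₁, f₁, c₁⟩ := hR q₁' h₁
    obtain ⟨q₂, h₂, f₂, c₂⟩ := hR q₂' h₂
    rw [f₁] at e₃ e₄
    rw [f₂] at e₁ ⊢
    have old := hlc.peak q₁ h₁ q₂ h₂ _ _ _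
      ⟨D, b, σ, τ, e₁, e₂, e₃, hArgs e₄, rfl, rfl, rfl⟩
    have hs : q₂.1.subst τ = (D.subst τ).fill (q₁.1.subst σ) := by rw [e₁, fill_subst, e₃]
    refine (ConvIn.trans ?_ (ConvIn.transfer hA (down _) old)).trans (ConvIn.symm ?_)
    · rw [hs]; exact c₁.gt_instantiate _ σ
    · exact c₂.gt_instantiate .hole τ
  · rintro q' hq e he _ _ _ ⟨D, b, σ, τ, e₁, e₂, e₃, e₄, rfl, rfl, rfl⟩
    obtain ⟨q, hq, f, c⟩ := hR q' hq
    rw [f] at e₃ e₄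
    obtain ⟨w, hw, hw'⟩ := hlc.cliff_inner q hq e he _ _ _
      ⟨D, b, σ, τ, e₁, e₂, e₃, hArgs e₄, rfl, rfl, rfl⟩
    obtain ⟨w', h₁, h₂⟩ := hstep (.of_symm_step ((Step.of_mem he).subst τ)) hw hw'
    refine ⟨w', h₁, ConvIn.trans ?_ h₂⟩
    rw [e₁, fill_subst, e₃]
    exact c.gt_instantiate _ σ
  · rintro q' hq e he _ _ _ ⟨D, b, σ, τ, e₁, e₂, e₃, e₄, rfl, rfl, rfl⟩
    obtain ⟨q, hq, f, c⟩ := hR q' hq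
    rw [f] at e₁ ⊢
    obtain ⟨w, hw, hw'⟩ := hlc.cliff_root q hq e he _ _ _
      ⟨D, b, σ, τ, e₁, e₂, e₃, hArgs e₄, rfl, rfl, rfl⟩
    have hsu : Conv B (q.1.subst τ) ((D.subst τ).fill (e.2.subst σ)) := by
      rw [e₁, fill_subst, e₃]
      exact .of_symm_step (((Step.of_mem he).subst σ).fill _)
    obtain ⟨w', h₁, h₂⟩ := hstep hsu hw hw'
    exact ⟨w', h₁, (c.gt_instantiate .hole τ).trans h₂⟩

end Overlaps

/-! ### Adding critical pairs -/

section Deduction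

variable {L : FirstOrder.Language.{u, v}} {V : Type w} {B C A X R : Set (TPair L V)}

theorem Represents.step {D S : Set (TPair L V)} (h : Represents D S) {e : TPair L V} (he : e ∈ S) :
    Step D e.1 e.2 := by
  obtain ⟨d, hd, hv⟩ := h.2.2 e he
  exact hv.step.mono (Set.singleton_subset_iff.2 hd)

theorem PrimeOverlap.mono {R' : Set (TPair L V)} (hR : R ⊆ R') {q₁ q₂ : TPair L V}
    {t s u : L.Term V} (h : PrimeOverlap R' q₁ q₂ t s u) : PrimeOverlap R q₁ q₂ t s u := by
  obtain ⟨D, b, σ, τ, e₁, e₂, e₃, e₄, r⟩ := h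
  exact ⟨D, b, σ, τ, e₁, e₂, e₃, fun b hb => (e₄ b hb).mono hR, r⟩

/-- A prime overlap is an instance of a critical pair or of a trivial one between variants. An
instance can only be prime if the critical peak itself is. -/
theorem PrimeOverlap.exists_critPair [Infinite V] (p : Bool) {R₁ R₂ : Set (TPair L V)}
    {q₁ q₂ : TPair L V} (h₁ : q₁ ∈ R₁) (h₂ : q₂ ∈ R₂) (hr₁ : IsRule q₁) (hr₂ : IsRule q₂)
    (hl₁ : Linear q₁.1) (hl₂ : Linear q₂.1) {t s u : L.Term V}
    (h : PrimeOverlap R q₁ q₂ t s u) :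
    (Variant q₁ q₂ ∧ t = u) ∨
      ∃ e ∈ critPairs p R R₁ R₂, ∃ δ : V → L.Term V, t = e.1.subst δ ∧ u = e.2.subst δ := by
  obtain ⟨D, b, σ, τ, e₁, e₂, e₃, e₄, rfl, rfl, rfl⟩ := h
  rcases exists_critPeak h₁ h₂ hr₁ hr₂ hl₁ hl₂ e₁ e₂ e₃ with
    ⟨rfl, hv⟩ | ⟨t, a, s, u, δ, hcp, f₁, -, f₃, f₄⟩
  · exact Or.inl ⟨hv, hv.subst_eq hr₁ (e₃.symm.trans (by rw [e₁, fill_hole]))⟩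
  · refine Or.inr ⟨(t, u), ⟨a, s, hcp, fun _ => ?_⟩, δ, f₃.symm, f₄.symm⟩
    rw [← f₁] at e₄
    exact e₄.of_subst

/-- A decreasing rule is not a variant of an axiom of `B`. -/
theorem not_variant_of_decreasing (hT : TerminatingMod B C) {q e : TPair L V}
    (hq : Gt B C q.1 q.2) (he : e ∈ symm B) : ¬ Variant q e := by
  intro hv
  have hdec : Decreasing B C {q} := fun q' hq' => by rw [Set.mem_singleton_iff.1 hq']; exact hq
  exact Gt.irrefl hT e.1
    ((hdec.step hv.step).conv_right (Conv.of_symm_step (Step.of_mem he)).symm)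

/-- A rule can be added to a locally connected system if representatives of its critical pairs with
the system are available as equations, and representatives of those with `B` as rules. -/
theorem LocallyConnected.insert_rule [Infinite V] (hB : LinearRegular B) (hT : TerminatingMod B C)
    (p : Bool) {ρ : TPair L V} (hlc : LocallyConnected B C A X R)
    (hrule : IsTRS (insert ρ R)) (hlin : ∀ q ∈ insert ρ R, Linear q.1)
    (hdec : Decreasing B C (insert ρ R)) {D K : Set (TPair L V)}
    (hD : Represents D (critPairs p (insert ρ R) {ρ} {ρ} ∪
      (critPairs p (insert ρ R) R {ρ} ∪ critPairs p (insert ρ R) {ρ} R)))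
    (hK : Represents K (Prod.swap '' critPairs p (insert ρ R) {ρ} (symm B) ∪
      critPairs p (insert ρ R) (symm B) {ρ})) (hDA : D ⊆ A) (hKX : K ⊆ X) :
    LocallyConnected B C A X (insert ρ R) := by
  have hsub : R ⊆ insert ρ R := Set.subset_insert ρ R
  have hρ : ρ ∈ insert ρ R := Set.mem_insert ρ R
  have peak : ∀ R₁ R₂ : Set (TPair L V), R₁ ⊆ insert ρ R → R₂ ⊆ insert ρ R →
      (∀ e ∈ critPairs p (insert ρ R) R₁ R₂, Step D e.1 e.2) →
      ∀ q₁ ∈ R₁, ∀ q₂ ∈ R₂, ∀ t s u, PrimeOverlap (insert ρ R) q₁ q₂ t s u →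
        ConvIn (Gt B C s) A t u := by
    intro R₁ R₂ hR₁ hR₂ hcp q₁ h₁ q₂ h₂ t s u h
    have m₁ := hR₁ h₁
    have m₂ := hR₂ h₂
    have st := h.steps
    rcases h.exists_critPair p h₁ h₂ (hrule _ m₁) (hrule _ m₂) (hlin _ m₁) (hlin _ m₂) with
      ⟨-, h⟩ | ⟨e, he, δ, rfl, rfl⟩
    · exact .of_eq h
    · exact .of_step (((hcp e he).mono hDA).subst δ)
        (hdec.step (st.1.mono (Set.singleton_subset_iff.2 m₁)))
        (hdec.step (st.2.mono (Set.singleton_subset_iff.2 m₂)))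
  have sρ : {ρ} ⊆ insert ρ R := Set.singleton_subset_iff.2 hρ
  have symmLin : ∀ e ∈ symm B, Linear e.1 := fun e he => (hB e he).2
  refine ⟨?_, ?_, ?_⟩
  · rintro q₁ (rfl | h₁) q₂ (rfl | h₂) t s u h
    · exact peak {q₂} {q₂} sρ sρ (fun e he => hD.step (Or.inl he)) q₂ rfl q₂ rfl t s u h
    · exact peak {q₁} R sρ hsub (fun e he => hD.step (Or.inr (Or.inr he))) q₁ rfl q₂ h₂ t s u h
    · exact peak R {q₂} hsub sρ (fun e he => hD.step (Or.inr (Or.inl he))) q₁ h₁ q₂ rfl t s u h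
    · exact hlc.peak q₁ h₁ q₂ h₂ t s u (h.mono hsub)
  · rintro q (rfl | hq) e he t s u h
    · rcases h.exists_critPair p (R₁ := {q}) (R₂ := symm B) rfl he (hrule _ hρ) (hB e he).1
        (hlin _ hρ) (hB e he).2 with ⟨hv, -⟩ | ⟨c, hc, δ, rfl, rfl⟩
      · exact absurd hv (not_variant_of_decreasing hT (hdec _ hρ) he)
      · exact ⟨_, ((hK.step (Or.inl ⟨c, hc, rfl⟩)).mono hKX).subst δ, .refl _⟩
    · exact hlc.cliff_inner q hq e he t s u (h.mono hsub)
  · rintro q (rfl | hq) e he t s u h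
    · rcases h.exists_critPair p (R₁ := symm B) (R₂ := {q}) he rfl (hB e he).1 (hrule _ hρ)
        (hB e he).2 (hlin _ hρ) with ⟨hv, -⟩ | ⟨c, hc, δ, rfl, rfl⟩
      · exact absurd hv.symm (not_variant_of_decreasing hT (hdec _ hρ) he)
      · exact ⟨_, ((hK.step (Or.inr hc)).mono hKX).subst δ, .refl _⟩
    · exact hlc.cliff_root q hq e he t s u (h.mono hsub)

theorem vars_subset_of_step (hR : IsTRS R) {s t : L.Term V} (h : Step R s t) :
    vars t ⊆ vars s := by
  obtain ⟨q, hq, D, σ, rfl, rfl⟩ := h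
  exact vars_fill_mono D (vars_subst_mono (hR q hq).2 σ)

theorem LinearRegular.vars_subset_of_conv (hB : LinearRegular B) {s t : L.Term V}
    (h : Conv B s t) : vars t ⊆ vars s := by
  have h' := h.symm_steps
  clear h
  induction h' with
  | refl => exact subset_rfl
  | tail _ h ih => exact (vars_subset_of_step (fun e he => (hB e he).1) h).trans ih

theorem vars_subset_of_steps (hB : LinearRegular B) (hR : IsTRS R) {s t : L.Term V}
    (h : Relation.ReflTransGen (StepMod B R) s t) : vars t ⊆ vars s := by
  induction h with
  | refl => exact subset_rfl
  | tail _ h ih =>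
    obtain ⟨a, b, h₁, h₂, h₃⟩ := h
    exact (((hB.vars_subset_of_conv h₃).trans (vars_subset_of_step hR h₂)).trans
      (hB.vars_subset_of_conv h₁)).trans ih

theorem ne_var_of_step (hR : IsTRS R) {s t : L.Term V} (h : Step R s t) (x : V) :
    s ≠ .var x := by
  rintro rfl
  obtain ⟨q, hq, D, σ, h, -⟩ := h
  cases D with
  | app f i ts D => simp at h
  | hole =>
    cases hq1 : q.1 with
    | var y => exact (hR q hq).1 y hq1
    | func f ts => simp [hq1] at h

/-- The pending rules obtained from critical pairs with a linear regular theory are decreasing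
left-linear rules. -/
theorem pending_of_critPairs (hB : LinearRegular B) (p : Bool) {ρ : TPair L V} (hr : IsRule ρ)
    (hl : Linear ρ.1) (hd : Gt B C ρ.1 ρ.2) {R' : Set (TPair L V)} {q : TPair L V}
    (hq : q ∈ Prod.swap '' critPairs p R' {ρ} (symm B) ∪ critPairs p R' (symm B) {ρ}) :
    IsRule q ∧ Linear q.1 ∧ Gt B C q.1 q.2 ∧ ∃ s, Step {ρ} s q.2 ∧ Conv B s q.1 := by
  have hBl : ∀ e ∈ symm B, Linear e.1 ∧ Linear e.2 := fun e he => ⟨(hB e he).2, hB.linear_snd he⟩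
  have hρl : ∀ q ∈ ({ρ} : Set (TPair L V)), Linear q.1 := by
    rintro _ rfl; exact hl
  have hρ : IsTRS {ρ} := by rintro _ rfl; exact hr
  have hρd : Decreasing B C {ρ} := by rintro _ rfl; exact hd
  have hBs : IsTRS (symm B) := fun e he => (hB e he).1
  obtain ⟨hlin, s, h₁, h₂⟩ : Linear q.1 ∧ ∃ s, Step {ρ} s q.2 ∧ Step (symm B) s q.1 := by
    rcases hq with ⟨q, ⟨a, s, hcp, -⟩, rfl⟩ | ⟨a, s, hcp, -⟩
    · exact ⟨hcp.linear_root hρl hBl, s, hcp.steps.1, hcp.steps.2⟩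
    · exact ⟨hcp.linear_inner hBl hρl, s, hcp.steps.2, hcp.steps.1⟩
  have hc : Conv B s q.1 := .of_symm_step h₂
  refine ⟨⟨?_, ?_⟩, hlin, (hρd.step h₁).of_conv_left hc.symm, s, h₁, hc⟩
  · exact ne_var_of_step hBs (step_symm.2 (step_symm.1 h₂).symm)
  · exact (vars_subset_of_step hρ h₁).trans (hB.vars_subset_of_conv hc.symm)

end Deduction

/-! ### The steps of an iteration -/

section Steps

variable {L : FirstOrder.Language.{u, v}} {V : Type w} {B C : Set (TPair L V)}

/-- All equations and rules of a state. -/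
def State.pairs (S : State L V) : Set (TPair L V) := S.E ∪ (S.P ∪ S.R)

/-- The part of the loop invariant that concerns the (pending) rules of a state and their
overlaps, with respect to the order induced by `C`. -/
structure StateInv (B C : Set (TPair L V)) (S : State L V) : Prop where
  isTRS : IsTRS (S.P ∪ S.R)
  linear : ∀ q ∈ S.P ∪ S.R, Linear q.1
  decreasing : Decreasing B C (S.P ∪ S.R)
  connected : LocallyConnected B C (S.pairs ∪ B) (S.P ∪ S.R) S.R

/-- The rules are interreduced, and the left-hand sides of the pending rules are irreducible with
respect to the rules. -/
structure Interreduced (S : State L V) : Prop where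
  left : LeftReduced S.R
  right : ∀ q ∈ S.R, NF S.R q.2
  pending : ∀ q ∈ S.P, NF S.R q.1

/-- Every equation of `S` is replaced in `S'` by a conversion through terms below one of its sides,
and every equation of `S'` is a consequence of `S`. -/
structure Refines (B C : Set (TPair L V)) (S S' : State L V) : Prop where
  forward : ∀ q ∈ S.pairs,
    ConvIn (fun x => Ge B C q.1 x ∨ Ge B C q.2 x) (S'.pairs ∪ B) q.1 q.2
  backward : ∀ q ∈ S'.pairs, Conv (S.pairs ∪ B) q.1 q.2

variable {S S' : State L V}

theorem Refines.forward_union (h : Refines B C S S') : ∀ q ∈ S.pairs ∪ B,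
    ConvIn (fun x => Ge B C q.1 x ∨ Ge B C q.2 x) (S'.pairs ∪ B) q.1 q.2 := by
  rintro q (hq | hq)
  · exact h.forward q hq
  · exact .of_step (.of_mem (Or.inr hq)) (Or.inl (.refl _)) (Or.inr (.refl _))

theorem Refines.conv_iff (h : Refines B C S S') (s t : L.Term V) :
    Conv (S.pairs ∪ B) s t ↔ Conv (S'.pairs ∪ B) s t := by
  constructor
  · exact Conv.transfer fun q hq => (h.forward_union q hq).conv
  · refine Conv.transfer ?_
    rintro q (hq | hq)
    · exact h.backward q hq
    · exact .of_step (.of_mem (Or.inr hq))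

theorem ConvIn.of_mem_pair {A : Set (TPair L V)} {q : TPair L V} (hq : q ∈ A) :
    ConvIn (fun x => Ge B C q.1 x ∨ Ge B C q.2 x) A q.1 q.2 :=
  .of_step (.of_mem hq) (Or.inl (.refl _)) (Or.inr (.refl _))

theorem subset_pairs_union : S.P ∪ S.R ⊆ S.pairs ∪ B := fun _ h => Or.inl (Or.inr h)

theorem Conv.of_steps {A R : Set (TPair L V)} (hA : R ∪ B ⊆ A) {s t : L.Term V}
    (h : Relation.ReflTransGen (StepMod B R) s t) : Conv A s t := by
  have hdec : Decreasing B R R := fun q hq => .single (.of_step (.of_mem hq))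
  exact (ConvIn.of_steps hdec hA h).conv

/-! ### Simplify and delete -/

/-- The equations left by simplify and delete. -/
def simplified (B : Set (TPair L V)) (g : L.Term V → L.Term V) (S : State L V) : State L V :=
  { S with E := {e | (∃ d ∈ S.E, e = (g d.1, g d.2)) ∧ ¬ Conv B e.1 e.2} }

theorem simplified_refines (hdec : Decreasing B C (S.P ∪ S.R)) {g : L.Term V → L.Term V}
    (hg : ∀ t, Relation.ReflTransGen (StepMod B (S.P ∪ S.R)) t (g t)) :
    Refines B C S (simplified B g S) := by
  constructor
  · rintro q (hq | hq)
    · have hA : S.P ∪ S.R ∪ B ⊆ (simplified B g S).pairs ∪ B :=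
        Set.union_subset_union_left _ fun _ h => Or.inr h
      have h₁ : ConvIn (Ge B C q.1) ((simplified B g S).pairs ∪ B) q.1 (g q.1) :=
        .of_steps hdec hA (hg q.1)
      have h₂ : ConvIn (Ge B C q.2) ((simplified B g S).pairs ∪ B) q.2 (g q.2) :=
        .of_steps hdec hA (hg q.2)
      have g₁ := hdec.steps (hg q.1)
      have g₂ := hdec.steps (hg q.2)
      refine ((h₁.mono fun _ => Or.inl).trans ?_).trans (h₂.mono fun _ => Or.inr).symm
      by_cases hc : Conv B (g q.1) (g q.2)
      · exact (ConvIn.of_conv Set.subset_union_right hc (.refl _)).mono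
          fun x hx => Or.inl (g₁.trans (Or.inl hx))
      · refine .of_step (Step.of_mem (q := (g q.1, g q.2)) (Or.inl (Or.inl ⟨⟨q, hq, rfl⟩, hc⟩)))
          (Or.inl g₁) (Or.inr g₂)
    · exact .of_mem_pair (Or.inl (Or.inr hq))
  · rintro q (⟨⟨d, hd, rfl⟩, -⟩ | hq)
    · have hA : S.P ∪ S.R ∪ B ⊆ S.pairs ∪ B := Set.union_subset_union_left _ fun _ h => Or.inr h
      exact ((Conv.of_steps hA (hg d.1)).symm.trans
        (.of_step (.of_mem (Or.inl (Or.inl hd))))).trans (Conv.of_steps hA (hg d.2))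
    · exact .of_step (.of_mem (Or.inl (Or.inr hq)))

theorem StateInv.simplified (h : StateInv B C S) {g : L.Term V → L.Term V}
    (hg : ∀ t, Relation.ReflTransGen (StepMod B (S.P ∪ S.R)) t (g t)) :
    StateInv B C (simplified B g S) where
  isTRS := h.isTRS
  linear := h.linear
  decreasing := h.decreasing
  connected := h.connected.transfer (simplified_refines h.decreasing hg).forward_union
    (fun q hq => ⟨q.2, .of_mem hq, .refl _⟩) (fun q hq => ⟨q, hq, rfl, .refl _⟩)
    (fun _ hq hn => hn _ (.of_mem hq))

/-! ### Choose, orient and deduce -/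

/-- What the selection of the rule `ρ` means for the equations and pending rules. -/
structure Selected (S : State L V) (ρ : TPair L V) (S' : State L V) : Prop where
  rules : S'.R = S.R
  equations : S'.E ⊆ S.E
  pending : S'.P ⊆ S.P
  constraints : S.C ⊆ S'.C
  kept_equations : ∀ q ∈ S.E, q ∈ S'.E ∨ q = ρ ∨ q = ρ.swap
  kept_pending : ∀ q ∈ S.P, q ∈ S'.P ∨ q = ρ
  origin : ρ ∈ S.P ∨ (ρ ∈ S'.C ∧ IsRule ρ ∧ Linear ρ.1 ∧ (ρ ∈ S.E ∨ ρ.swap ∈ S.E))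

theorem Orients.acceptable {tt : Set (TPair L V) → Prop} {lr : Bool} {e ρ : TPair L V}
    (h : Orients tt lr C e ρ) : Acceptable tt C ρ ∧ (e = ρ ∨ e = ρ.swap) := by
  unfold Orients at h
  cases lr <;> rcases h with ⟨h, rfl⟩ | ⟨-, h, rfl⟩ <;> exact ⟨h, by simp⟩

theorem Select.selected {tt : Set (TPair L V) → Prop} {lr : Bool} {ρ : TPair L V}
    (h : Select tt lr S ρ S') : Selected S ρ S' := by
  classical
  cases h with
  | pending _ hρ _ =>
    exact ⟨rfl, subset_rfl, Set.sdiff_subset, subset_rfl, fun q hq => Or.inl hq,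
      fun q hq => (em (q = ρ)).symm.imp (fun h => ⟨hq, h⟩) id, Or.inl hρ⟩
  | equation e _ he _ ho =>
    obtain ⟨hacc, hρ⟩ := ho.acceptable
    refine ⟨rfl, Set.sdiff_subset, subset_rfl, Set.subset_insert _ _, fun q hq => ?_,
      fun q hq => Or.inl hq, Or.inr ⟨Set.mem_insert _ _, hacc.1, hacc.2.1, ?_⟩⟩
    · by_cases hqe : q = e
      · exact Or.inr (hqe ▸ hρ)
      · exact Or.inl ⟨hq, hqe⟩
    · rcases hρ with rfl | rfl
      · exact Or.inl he
      · exact Or.inr he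

theorem Selected.isRule {ρ : TPair L V} (hs : Selected S ρ S') (h : StateInv B C S)
    (hC : S'.C ⊆ C) : IsRule ρ ∧ Linear ρ.1 ∧ Gt B C ρ.1 ρ.2 := by
  rcases hs.origin with hρ | ⟨hρ, h₁, h₂, -⟩
  · exact ⟨h.isTRS _ (Or.inl hρ), h.linear _ (Or.inl hρ), h.decreasing _ (Or.inl hρ)⟩
  · exact ⟨h₁, h₂, .single (.of_step (.of_mem (hC hρ)))⟩

/-- The state after deduce, with new equations `D` and new pending rules `K`. -/
def deduced (ρ : TPair L V) (D K : Set (TPair L V)) (S : State L V) : State L V :=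
  { E := S.E ∪ D, P := S.P ∪ K, R := insert ρ S.R, C := S.C }

variable {ρ : TPair L V} {D K : Set (TPair L V)} {p : Bool}

theorem deduced_rules_subset (hs : Selected S ρ S') :
    S.P ∪ S.R ⊆ (deduced ρ D K S').P ∪ (deduced ρ D K S').R := by
  rintro q (hq | hq)
  · rcases hs.kept_pending q hq with h | rfl
    · exact Or.inl (Or.inl h)
    · exact Or.inr (Or.inl rfl)
  · exact Or.inr (Or.inr (hs.rules.symm ▸ hq))

theorem deduced_refines (hs : Selected S ρ S')
    (hD : D ⊆ critPairs p (insert ρ S'.R) {ρ} {ρ} ∪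
      (critPairs p (insert ρ S'.R) S'.R {ρ} ∪ critPairs p (insert ρ S'.R) {ρ} S'.R))
    (hK : K ⊆ Prod.swap '' critPairs p (insert ρ S'.R) {ρ} (symm B) ∪
      critPairs p (insert ρ S'.R) (symm B) {ρ}) :
    Refines B C S (deduced ρ D K S') := by
  have hρ : ρ ∈ (deduced ρ D K S').pairs ∪ B := Or.inl (Or.inr (Or.inr (Or.inl rfl)))
  constructor
  · rintro q (hq | hq)
    · rcases hs.kept_equations q hq with h | rfl | rfl
      · exact .of_mem_pair (Or.inl (Or.inl (Or.inl h)))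
      · exact .of_mem_pair hρ
      · exact (ConvIn.of_mem_pair hρ).symm.mono fun _ => Or.symm
    · exact .of_mem_pair (Or.inl (Or.inr (deduced_rules_subset hs hq)))
  · have hcρ : Conv (S.pairs ∪ B) ρ.1 ρ.2 := by
      rcases hs.origin with h | ⟨-, -, -, h | h⟩
      · exact .of_step (.of_mem (Or.inl (Or.inr (Or.inl h))))
      · exact .of_step (.of_mem (Or.inl (Or.inl h)))
      · exact (Conv.of_step (Step.of_mem (q := ρ.swap) (Or.inl (Or.inl h)))).symm
    have hcR : ∀ q ∈ insert ρ S'.R, Conv (S.pairs ∪ B) q.1 q.2 := by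
      rintro q (rfl | hq)
      · exact hcρ
      · exact .of_step (.of_mem (Or.inl (Or.inr (Or.inr (hs.rules ▸ hq)))))
    have hstep : ∀ R' ⊆ insert ρ S'.R, ∀ {s t : L.Term V}, Step R' s t →
        Conv (S.pairs ∪ B) s t := fun R' hR' s t h =>
      (Conv.of_step h).transfer fun q hq => hcR q (hR' hq)
    have hBstep : ∀ {s t : L.Term V}, Step (symm B) s t → Conv (S.pairs ∪ B) s t := fun h =>
      (Conv.of_symm_step h).mono Set.subset_union_right
    have sρ : {ρ} ⊆ insert ρ S'.R := Set.singleton_subset_iff.2 (Set.mem_insert _ _)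
    have sR : S'.R ⊆ insert ρ S'.R := Set.subset_insert _ _
    have hcp : ∀ R₁ ⊆ insert ρ S'.R, ∀ R₂ ⊆ insert ρ S'.R,
        ∀ q ∈ critPairs p (insert ρ S'.R) R₁ R₂, Conv (S.pairs ∪ B) q.1 q.2 := by
      rintro R₁ h₁ R₂ h₂ q ⟨a, s, hcp, -⟩
      exact (hstep R₁ h₁ hcp.steps.1).symm.trans (hstep R₂ h₂ hcp.steps.2)
    rintro q ((hq | hq) | (hq | hq) | hq)
    · exact .of_step (.of_mem (Or.inl (Or.inl (hs.equations hq))))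
    · rcases hD hq with h | h | h
      · exact hcp _ sρ _ sρ q h
      · exact hcp _ sR _ sρ q h
      · exact hcp _ sρ _ sR q h
    · exact .of_step (.of_mem (Or.inl (Or.inr (Or.inl (hs.pending hq)))))
    · rcases hK hq with ⟨q, ⟨a, s, hcp, -⟩, rfl⟩ | ⟨a, s, hcp, -⟩
      · exact (hBstep hcp.steps.2).symm.trans (hstep _ sρ hcp.steps.1)
      · exact (hBstep hcp.steps.1).symm.trans (hstep _ sρ hcp.steps.2)
    · exact hcR q hq

theorem StateInv.deduced [Infinite V] (hB : LinearRegular B) (hT : TerminatingMod B C)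
    (h : StateInv B C S) (hs : Selected S ρ S') (hC : S'.C ⊆ C)
    (hD : Represents D (critPairs p (insert ρ S'.R) {ρ} {ρ} ∪
      (critPairs p (insert ρ S'.R) S'.R {ρ} ∪ critPairs p (insert ρ S'.R) {ρ} S'.R)))
    (hK : Represents K (Prod.swap '' critPairs p (insert ρ S'.R) {ρ} (symm B) ∪
      critPairs p (insert ρ S'.R) (symm B) {ρ})) :
    StateInv B C (deduced ρ D K S') := by
  have hρ := hs.isRule h hC
  have key : ∀ q ∈ (LLAC.deduced ρ D K S').P ∪ (LLAC.deduced ρ D K S').R,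
      IsRule q ∧ Linear q.1 ∧ Gt B C q.1 q.2 := by
    rintro q ((hq | hq) | (rfl | hq))
    · have hq' : q ∈ S.P ∪ S.R := Or.inl (hs.pending hq)
      exact ⟨h.isTRS q hq', h.linear q hq', h.decreasing q hq'⟩
    · obtain ⟨h₁, h₂, h₃, -⟩ := pending_of_critPairs hB p hρ.1 hρ.2.1 hρ.2.2 (hK.2.1 hq)
      exact ⟨h₁, h₂, h₃⟩
    · exact hρ
    · have hq' : q ∈ S.P ∪ S.R := Or.inr (hs.rules ▸ hq)
      exact ⟨h.isTRS q hq', h.linear q hq', h.decreasing q hq'⟩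
  have old : LocallyConnected B C ((LLAC.deduced ρ D K S').pairs ∪ B)
      ((LLAC.deduced ρ D K S').P ∪ (LLAC.deduced ρ D K S').R) S'.R := by
    refine h.connected.transfer (deduced_refines hs hD.2.1 hK.2.1).forward_union
      (fun q hq => ⟨q.2, .of_mem (deduced_rules_subset hs hq), .refl _⟩)
      (fun q hq => ⟨q, hs.rules ▸ hq, rfl, .refl _⟩) (fun q hq hn => hn q.2 ?_)
    exact .of_mem (hs.rules.symm ▸ hq)
  have hsub : insert ρ S'.R ⊆ (LLAC.deduced ρ D K S').P ∪ (LLAC.deduced ρ D K S').R :=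
    fun q hq => Or.inr hq
  exact
    { isTRS := fun q hq => (key q hq).1
      linear := fun q hq => (key q hq).2.1
      decreasing := fun q hq => (key q hq).2.2
      connected := old.insert_rule hB hT p (fun q hq => (key q (hsub hq)).1)
        (fun q hq => (key q (hsub hq)).2.1) (fun q hq => (key q (hsub hq)).2.2) hD hK
        (fun q hq => Or.inl (Or.inl (Or.inr hq))) (fun q hq => Or.inl (Or.inr hq)) }

/-! ### Compose -/

/-- The state after compose, where `g` computes normal forms. -/
def composed (g : L.Term V → L.Term V) (S : State L V) : State L V :=
  { S with P := (fun q => (q.1, g q.2)) '' S.P, R := (fun q => (q.1, g q.2)) '' S.R }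

theorem mem_composed_rules {g : L.Term V → L.Term V} {q : TPair L V} :
    q ∈ (composed g S).P ∪ (composed g S).R ↔ ∃ d ∈ S.P ∪ S.R, q = (d.1, g d.2) := by
  constructor
  · rintro (⟨d, hd, rfl⟩ | ⟨d, hd, rfl⟩)
    · exact ⟨d, Or.inl hd, rfl⟩
    · exact ⟨d, Or.inr hd, rfl⟩
  · rintro ⟨d, hd | hd, rfl⟩
    · exact Or.inl ⟨d, hd, rfl⟩
    · exact Or.inr ⟨d, hd, rfl⟩

/-- All rules are composed simultaneously. Hence the steps from `r` to `g r` for a rule `ℓ → r` are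
in turn replaced; this ends because they start at terms below `ℓ`. -/
theorem convIn_of_composed {Z A : Set (TPair L V)} (hT : TerminatingMod B C)
    (hdec : Decreasing B C Z) {g : L.Term V → L.Term V}
    (hg : ∀ t, Relation.ReflTransGen (StepMod B Z) t (g t)) (hB : B ⊆ A)
    (hA : ∀ q ∈ Z, (q.1, g q.2) ∈ A) (s : L.Term V) :
    ∀ t, Step Z s t → ConvIn (Ge B C s) A s t := by
  induction s using (Gt.wellFounded hT).induction with
  | _ s ih =>
    rintro t ⟨q, hq, D, σ, rfl, rfl⟩
    have h₁ : Step Z (D.fill (q.1.subst σ)) (D.fill (q.2.subst σ)) :=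
      ((Step.of_mem hq).subst σ).fill D
    have h₂ : Step A (D.fill (q.1.subst σ)) (D.fill ((g q.2).subst σ)) :=
      ((Step.of_mem (hA q hq)).subst σ).fill D
    have h₃ : Relation.ReflTransGen (StepMod B Z) (D.fill (q.2.subst σ))
        (D.fill ((g q.2).subst σ)) :=
      reflTransGen_map (fun x : L.Term V => D.fill (x.subst σ))
        (fun _ _ h => (StepMod.subst h σ).fill D) (hg q.2)
    have hgt := hdec.step h₁
    have h₄ : ConvIn (Ge B C (D.fill (q.2.subst σ))) A (D.fill (q.2.subst σ))
        (D.fill ((g q.2).subst σ)) :=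
      .of_steps_of hdec hB (fun a b ha hab => ih a (hgt.ge_right ha) b hab) h₃
    exact (ConvIn.of_step h₂ (.refl _) (Or.inr (hgt.ge_right (hdec.steps h₃)))).trans
      (h₄.symm.mono fun x hx => Or.inr (hgt.ge_right hx))

variable {g : L.Term V → L.Term V}

theorem convIn_of_step_composed (hT : TerminatingMod B C) (hdec : Decreasing B C (S.P ∪ S.R))
    (hg : ∀ t, Relation.ReflTransGen (StepMod B (S.P ∪ S.R)) t (g t)) {s t : L.Term V}
    (h : Step (S.P ∪ S.R) s t) : ConvIn (Ge B C s) ((composed g S).pairs ∪ B) s t :=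
  convIn_of_composed hT hdec hg Set.subset_union_right
    (fun q hq => Or.inl (Or.inr (mem_composed_rules.2 ⟨q, hq, rfl⟩))) s t h

theorem composed_refines (hT : TerminatingMod B C) (hdec : Decreasing B C (S.P ∪ S.R))
    (hg : ∀ t, Relation.ReflTransGen (StepMod B (S.P ∪ S.R)) t (g t)) :
    Refines B C S (composed g S) := by
  constructor
  · rintro q (hq | hq)
    · exact .of_mem_pair (Or.inl (Or.inl hq))
    · exact (convIn_of_step_composed hT hdec hg (Step.of_mem hq)).mono fun _ => Or.inl
  · rintro q (hq | hq)
    · exact .of_step (.of_mem (Or.inl (Or.inl hq)))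
    · obtain ⟨d, hd, rfl⟩ := mem_composed_rules.1 hq
      exact (Conv.of_step (Step.of_mem (q := d) (Or.inl (Or.inr hd)))).trans
        (Conv.of_steps (t := g d.2) (Set.union_subset_union_left _ fun _ h => Or.inr h) (hg d.2))

theorem StateInv.composed (hB : LinearRegular B) (hT : TerminatingMod B C) (h : StateInv B C S)
    (hg : ∀ t, Relation.ReflTransGen (StepMod B (S.P ∪ S.R)) t (g t)) :
    StateInv B C (composed g S) := by
  have hconn : ∀ q ∈ S.P ∪ S.R,
      ConvIn (Gt B C q.1) ((LLAC.composed g S).pairs ∪ B) q.2 (g q.2) := by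
    intro q hq
    refine ConvIn.mono (ConvIn.of_steps_of h.decreasing Set.subset_union_right
      (fun a b _ hab => convIn_of_step_composed hT h.decreasing hg hab) (hg q.2)) ?_
    exact fun x hx => (h.decreasing q hq).ge_right hx
  refine ⟨?_, ?_, ?_, ?_⟩
  · intro q hq
    obtain ⟨d, hd, rfl⟩ := mem_composed_rules.1 hq
    exact ⟨(h.isTRS d hd).1, (vars_subset_of_steps hB h.isTRS (hg d.2)).trans (h.isTRS d hd).2⟩
  · intro q hq
    obtain ⟨d, hd, rfl⟩ := mem_composed_rules.1 hq
    exact h.linear d hd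
  · intro q hq
    obtain ⟨d, hd, rfl⟩ := mem_composed_rules.1 hq
    exact (h.decreasing d hd).ge_right (h.decreasing.steps (hg d.2))
  · refine h.connected.transfer (composed_refines hT h.decreasing hg).forward_union ?_ ?_ ?_
    · intro q hq
      exact ⟨g q.2, Step.of_mem (q := (q.1, g q.2)) (mem_composed_rules.2 ⟨q, hq, rfl⟩),
        hconn q hq⟩
    · rintro _ ⟨q, hq, rfl⟩
      exact ⟨q, hq, rfl, (hconn q (Or.inr hq)).symm⟩
    · intro q hq hn
      exact hn (g q.2) (Step.of_mem (q := (q.1, g q.2)) ⟨q, hq, rfl⟩)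

/-! ### Collapse -/

/-- What collapsing with `ρ` means for the equations and rules. -/
structure Collapsed (ρ : TPair L V) (S S' : State L V) : Prop where
  rules : S'.R ⊆ S.R
  pending : S'.P ⊆ S.P
  equations : S.E ⊆ S'.E
  rules_iff : ∀ q ∈ S.R, q ∈ S'.R ↔ (q = ρ ∨ NF {ρ} q.1)
  pending_iff : ∀ q ∈ S.P, q ∈ S'.P ↔ NF S.R q.1
  new_of_rule : ∀ q ∈ S.R, q ∉ S'.R → ∃ c, Step {ρ} q.1 c ∧ (c, q.2) ∈ S'.E
  new_of_pending : ∀ q ∈ S.P, q ∉ S'.P → ∃ c, Step S.R q.1 c ∧ (c, q.2) ∈ S'.E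
  origin : ∀ e ∈ S'.E, e ∈ S.E ∨ ∃ q ∈ S.P ∪ S.R, Step (insert ρ S.R) q.1 e.1 ∧ e.2 = q.2
  constraints : S'.C = S.C

theorem Collapse.collapsed (h : Collapse ρ S S') : Collapsed ρ S S' := by
  obtain ⟨c, d, hc, hd, rfl⟩ := h
  refine ⟨Set.sdiff_subset, Set.sdiff_subset, Set.subset_union_left, ?_, ?_, ?_, ?_, ?_, rfl⟩
  · intro q hq
    simp only [Set.mem_sdiff, hq, true_and, Set.mem_ofPred_eq, not_and, not_not]
    exact ⟨fun h => (em (q = ρ)).imp id h, fun h hne => h.resolve_left hne⟩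
  · intro q hq
    simp only [Set.mem_sdiff, hq, true_and, Set.mem_ofPred_eq, not_not]
  · intro q hq hn
    have hq' : q ∈ {q ∈ S.R | q ≠ ρ ∧ ¬ NF {ρ} q.1} := by
      by_contra h; exact hn ⟨hq, h⟩
    exact ⟨c q, hc q hq', Or.inr (Or.inl ⟨q, hq', rfl⟩)⟩
  · intro q hq hn
    have hq' : q ∈ {q ∈ S.P | ¬ NF S.R q.1} := by
      by_contra h; exact hn ⟨hq, h⟩
    exact ⟨d q, hd q hq', Or.inr (Or.inr ⟨q, hq', rfl⟩)⟩
  · rintro e (he | ⟨q, hq, rfl⟩ | ⟨q, hq, rfl⟩)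
    · exact Or.inl he
    · exact Or.inr ⟨q, Or.inr hq.1, (hc q hq).mono (Set.singleton_subset_iff.2 (Or.inl rfl)), rfl⟩
    · exact Or.inr ⟨q, Or.inl hq.1, (hd q hq).mono (Set.subset_insert _ _), rfl⟩

/-- A collapsed rule `ℓ → r` is replaced by a step `ℓ → u` with `ρ` and the equation `u ≈ r`. -/
theorem Collapsed.rule_step (hs : Collapsed ρ S S') (hρ : ρ ∈ S.R)
    (hdec : Decreasing B C (S.P ∪ S.R)) {q : TPair L V} (hq : q ∈ S.R) :
    ∃ w, Step S'.R q.1 w ∧ ConvIn (Gt B C q.1) (S'.pairs ∪ B) q.2 w := by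
  by_cases h : q ∈ S'.R
  · exact ⟨q.2, .of_mem h, .refl _⟩
  · obtain ⟨c, hc, he⟩ := hs.new_of_rule q hq h
    have hρ' : ρ ∈ S'.R := (hs.rules_iff ρ hρ).2 (Or.inl rfl)
    refine ⟨c, hc.mono (Set.singleton_subset_iff.2 hρ'), ConvIn.symm ?_⟩
    refine .of_step (Step.of_mem (q := (c, q.2)) (Or.inl (Or.inl he))) ?_
      (hdec q (Or.inr hq))
    exact hdec.step (hc.mono (Set.singleton_subset_iff.2 (Or.inr hρ)))

/-- A collapsed pending rule is treated in the same way; the rule of `S` used for its first step may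
itself be collapsed. -/
theorem Collapsed.pending_step (hs : Collapsed ρ S S') (hρ : ρ ∈ S.R)
    (hdec : Decreasing B C (S.P ∪ S.R)) {q : TPair L V} (hq : q ∈ S.P ∪ S.R) :
    ∃ w, Step (S'.P ∪ S'.R) q.1 w ∧ ConvIn (Gt B C q.1) (S'.pairs ∪ B) q.2 w := by
  rcases hq with hq | hq
  · by_cases h : q ∈ S'.P
    · exact ⟨q.2, .of_mem (Or.inl h), .refl _⟩
    · obtain ⟨c, hc, he⟩ := hs.new_of_pending q hq h
      have hgt := hdec.step (hc.mono Set.subset_union_right)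
      have h₁ : ConvIn (Gt B C q.1) (S'.pairs ∪ B) q.2 c := (ConvIn.of_step
        (Step.of_mem (q := (c, q.2)) (Or.inl (Or.inl he))) hgt (hdec q (Or.inl hq))).symm
      obtain ⟨q', hq', D, σ, e₁, e₂⟩ := hc
      obtain ⟨w, hw, hw'⟩ := hs.rule_step hρ hdec hq'
      refine ⟨_, e₁ ▸ ((hw.subst σ).fill D).mono Set.subset_union_right, h₁.trans ?_⟩
      rw [e₁, e₂]
      exact hw'.gt_instantiate D σ
  · obtain ⟨w, hw, hw'⟩ := hs.rule_step hρ hdec hq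
    exact ⟨w, hw.mono Set.subset_union_right, hw'⟩

theorem Collapsed.decreasing (hs : Collapsed ρ S S') (hdec : Decreasing B C (S.P ∪ S.R)) :
    Decreasing B C (S'.P ∪ S'.R) :=
  fun q hq => hdec q (hq.imp (fun h => hs.pending h) (fun h => hs.rules h))

theorem Collapsed.refines (hs : Collapsed ρ S S') (hρ : ρ ∈ S.R)
    (hdec : Decreasing B C (S.P ∪ S.R)) : Refines B C S S' := by
  constructor
  · rintro q (hq | hq)
    · exact .of_mem_pair (Or.inl (Or.inl (hs.equations hq)))
    · obtain ⟨w, hw, hw'⟩ := hs.pending_step hρ hdec hq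
      refine ((hs.decreasing hdec).convIn_of_step subset_pairs_union hw |>.mono
        fun _ => Or.inl).trans ?_
      exact (hw'.mono fun x hx => Or.inl (Or.inr hx)).symm
  · have hmem : ∀ q ∈ S.P ∪ S.R, Conv (S.pairs ∪ B) q.1 q.2 := fun q hq =>
      .of_step (.of_mem (Or.inl (Or.inr hq)))
    rintro q (hq | hq)
    · rcases hs.origin q hq with h | ⟨d, hd, h, e⟩
      · exact .of_step (.of_mem (Or.inl (Or.inl h)))
      · rw [e]
        rw [Set.insert_eq_of_mem hρ] at h
        exact (Conv.of_step (h.mono fun _ h => Or.inl (Or.inr (Or.inr h)))).symm.trans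
          (hmem d hd)
    · exact hmem q (hq.imp (fun h => hs.pending h) (fun h => hs.rules h))

theorem StateInv.collapsed (h : StateInv B C S) (hs : Collapsed ρ S S') (hρ : ρ ∈ S.R) :
    StateInv B C S' := by
  have hsub : S'.P ∪ S'.R ⊆ S.P ∪ S.R := Set.union_subset_union hs.pending hs.rules
  refine ⟨fun q hq => h.isTRS q (hsub hq), fun q hq => h.linear q (hsub hq),
    hs.decreasing h.decreasing, ?_⟩
  refine h.connected.transfer (hs.refines hρ h.decreasing).forward_union
    (fun q hq => hs.pending_step hρ h.decreasing hq)
    (fun q hq => ⟨q, hs.rules hq, rfl, .refl _⟩) (fun q hq hn => ?_)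
  obtain ⟨w, hw, -⟩ := hs.rule_step hρ h.decreasing hq
  exact hn w hw

end Steps

/-! ### The loop invariant -/

section Loop

variable {L : FirstOrder.Language.{u, v}} {V : Type w}

theorem Options.stepMod_of_rew (o : Options) (ac : Set (L.Functions 2)) {X : Set (TPair L V)}
    {s t : L.Term V} (h : o.rew ac X s t) : StepMod (AC V ac) X s t := by
  obtain ⟨mode, p⟩ := o
  cases mode
  · exact .of_step h
  · exact StepPS.stepMod h
  · exact h

theorem Options.rew_of_step (o : Options) (ac : Set (L.Functions 2)) {X : Set (TPair L V)}
    {s t : L.Term V} (h : Step X s t) : o.rew ac X s t := by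
  obtain ⟨mode, p⟩ := o
  cases mode
  · exact h
  · obtain ⟨q, hq, C, σ, rfl, rfl⟩ := h
    exact ⟨q, hq, C, σ, _, rfl, .refl _, rfl⟩
  · exact .of_step h

theorem IsNormalizer.steps {o : Options} {ac : Set (L.Functions 2)} {X : Set (TPair L V)}
    {g : L.Term V → L.Term V} (h : IsNormalizer (o.rew ac X) g) (t : L.Term V) :
    Relation.ReflTransGen (StepMod (AC V ac) X) t (g t) :=
  reflTransGen_map id (fun _ _ h => o.stepMod_of_rew ac h) (h t).1

theorem IsNormalizer.nf {o : Options} {ac : Set (L.Functions 2)} {X : Set (TPair L V)}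
    {g : L.Term V → L.Term V} (h : IsNormalizer (o.rew ac X) g) (t : L.Term V) : NF X (g t) :=
  fun u hu => (h t).2 u (o.rew_of_step ac hu)

theorem linearRegular_AC (ac : Set (L.Functions 2)) : LinearRegular (AC V ac) := by
  have v₂ : ∀ (f : L.Functions 2) (s t : L.Term V), vars (f.apply₂ s t) = vars s ∪ vars t := by
    intro f s t
    ext x
    simp [FirstOrder.Language.Functions.apply₂, Fin.exists_fin_two]
  have l₂ : ∀ (f : L.Functions 2) (s t : L.Term V), Linear s → Linear t →
      Disjoint (vars s) (vars t) → Linear (f.apply₂ s t) := by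
    intro f s t hs ht hd
    simp [FirstOrder.Language.Functions.apply₂, Fin.forall_fin_two, hs, ht, hd, hd.symm]
  have n₂ : ∀ (f : L.Functions 2) (s t : L.Term V) (x : V), f.apply₂ s t ≠ .var x := by
    intro f s t x
    simp [FirstOrder.Language.Functions.apply₂]
  rintro e ((⟨f, -, x, y, hxy, rfl⟩ | ⟨f, -, x, y, z, hxy, hyz, hxz, rfl⟩) |
    ⟨e, (⟨f, -, x, y, hxy, rfl⟩ | ⟨f, -, x, y, z, hxy, hyz, hxz, rfl⟩), rfl⟩)
  · exact ⟨⟨n₂ _ _ _, by simp [v₂, Set.pair_comm]⟩, l₂ _ _ _ (by simp) (by simp) (by simpa)⟩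
  · refine ⟨⟨n₂ _ _ _, by simp [v₂]⟩, ?_⟩
    exact l₂ _ _ _ (l₂ _ _ _ (by simp) (by simp) (by simpa)) (by simp)
      (by simp [v₂, hxz.symm, hyz.symm])
  · exact ⟨⟨n₂ _ _ _, by simp [v₂, Set.pair_comm]⟩,
      l₂ _ _ _ (by simp) (by simp) (by simpa using hxy.symm)⟩
  · refine ⟨⟨n₂ _ _ _, by simp [v₂]⟩, ?_⟩
    exact l₂ _ _ _ (by simp) (l₂ _ _ _ (by simp) (by simp) (by simpa))
      (by simp [v₂, hxy, hxz])

/-- Interreduction is established by normalizing right-hand sides and collapsing, as the left-hand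
side of the new rule `ρ` is irreducible with respect to the old rules. -/
theorem Interreduced.of_iteration {S S' S'' : State L V} {ρ : TPair L V} {D K : Set (TPair L V)}
    {g : L.Term V → L.Term V} (h : Interreduced S) (hs : Selected S ρ S') (hρ : NF S.R ρ.1)
    (hg : ∀ t, NF ((deduced ρ D K S').P ∪ (deduced ρ D K S').R) (g t))
    (hc : Collapsed (ρ.1, g ρ.2) (composed g (deduced ρ D K S')) S'') : Interreduced S'' := by
  have mem : ∀ q ∈ S''.R, ∃ d ∈ insert ρ S.R, q = (d.1, g d.2) := by
    intro q hq
    obtain ⟨d, hd, rfl⟩ := hc.rules hq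
    exact ⟨d, by simpa only [deduced, hs.rules] using hd, rfl⟩
  -- Old left-hand sides reduce the same terms before and after composition.
  have old : ∀ d ∈ S.R, ∀ {X : Set (TPair L V)} {t : L.Term V}, d ∈ X → NF X t →
      NF {((d.1, g d.2) : TPair L V)} t := by
    intro d _ X t hd ht
    refine NF.of_lhs (fun q hq hn => ?_) ht
    rw [Set.mem_singleton_iff.1 hq] at hn
    exact hn d.2 (Step.of_mem (q := d) hd)
  refine ⟨?_, ?_, ?_⟩
  · rintro q hq u ⟨q', ⟨hq', hne⟩, r⟩
    obtain ⟨d, hd, rfl⟩ := mem q hq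
    obtain ⟨d', hd', rfl⟩ := mem q' hq'
    have hu : Step {((d'.1, g d'.2) : TPair L V)} d.1 u := ⟨_, rfl, r⟩
    have hdd : d' ≠ d := fun e => hne (by rw [e]; rfl)
    rcases hd' with rfl | hd'
    · -- Reducible old rules are collapsed.
      rcases (hc.rules_iff _ (hc.rules hq)).1 hq with e | hn
      · exact hne e.symm
      · exact hn u hu
    · rcases hd with rfl | hd
      · exact old d' hd' hd' hρ u hu
      · exact old d' hd' (X := S.R \ {d}) ⟨hd', hdd⟩ (h.left d hd) u hu
  · intro q hq
    obtain ⟨d, hd, rfl⟩ := mem q hq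
    refine NF.of_lhs (fun q' hq' hn => ?_) (hg d.2)
    obtain ⟨d', hd', rfl⟩ := mem q' hq'
    exact hn d'.2 (Step.of_mem (q := d') (Or.inr (by simpa only [deduced, hs.rules] using hd')))
  · intro q hq
    exact ((hc.pending_iff q (hc.pending hq)).1 hq).mono hc.rules

/-- The loop invariant of a thread started with the equations `E₀`. The properties of the rules hold
with respect to every terminating extension of the constraints, in particular to the final ones. -/
structure LoopInv (tt : Set (TPair L V) → Prop) (ac : Set (L.Functions 2))
    (E₀ : Set (TPair L V)) (S : State L V) : Prop where
  finite : S.C.Finite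
  isTRS : IsTRS S.C
  accepted : S.C = ∅ ∨ tt S.C
  interreduced : Interreduced S
  rules : ∀ C, S.C ⊆ C → TerminatingMod (AC V ac) C → StateInv (AC V ac) C S
  presents : ∀ s t, Conv (E₀ ∪ AC V ac) s t ↔ Conv (S.pairs ∪ AC V ac) s t

variable {tt : Set (TPair L V) → Prop} {ac : Set (L.Functions 2)} {E₀ : Set (TPair L V)}
  {S S' : State L V}

theorem SoundTool.terminating (htt : SoundTool ac tt) {C : Set (TPair L V)} (hf : C.Finite)
    (hC : IsTRS C) (h : C = ∅ ∨ tt C) : TerminatingMod (AC V ac) C := by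
  rcases h with rfl | h
  · rintro ⟨f, hf⟩
    obtain ⟨_, _, _, ⟨q, hq, -⟩, -⟩ := hf 0
    exact hq
  · exact htt C hf hC h

theorem loopInv_init : LoopInv tt ac E₀ { E := E₀, P := ∅, R := ∅, C := ∅ } where
  finite := Set.finite_empty
  isTRS := fun _ h => h.elim
  accepted := Or.inl rfl
  interreduced := ⟨fun _ h => h.elim, fun _ h => h.elim, fun _ h => h.elim⟩
  rules C _ _ := by
    have hempty : ∀ q : TPair L V, q ∉ (∅ ∪ ∅ : Set (TPair L V)) := by simp
    exact ⟨fun q h => (hempty q h).elim, fun q h => (hempty q h).elim,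
      fun q h => (hempty q h).elim, fun _ h => h.elim, fun _ h => h.elim, fun _ h => h.elim⟩
  presents s t := by simp [State.pairs]

theorem Select.constraints {lr : Bool} {ρ : TPair L V} (h : Select tt lr S ρ S')
    (hf : S.C.Finite) (hC : IsTRS S.C) (ha : S.C = ∅ ∨ tt S.C) :
    S'.C.Finite ∧ IsTRS S'.C ∧ (S'.C = ∅ ∨ tt S'.C) := by
  cases h with
  | pending => exact ⟨hf, hC, ha⟩
  | equation e _ _ _ ho =>
    have hacc := ho.acceptable.1
    refine ⟨hf.insert _, ?_, Or.inr hacc.2.2⟩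
    rintro q (rfl | hq)
    · exact hacc.1
    · exact hC q hq

theorem LoopInv.simplifyDelete {o : Options} (htt : SoundTool ac tt) (h : LoopInv tt ac E₀ S)
    (hS : SimplifyDelete o ac S S') : LoopInv tt ac E₀ S' := by
  obtain ⟨g, hg, rfl⟩ := hS
  have hT := htt.terminating h.finite h.isTRS h.accepted
  refine ⟨h.finite, h.isTRS, h.accepted,
    ⟨h.interreduced.left, h.interreduced.right, h.interreduced.pending⟩,
    fun C hC hT => (h.rules C hC hT).simplified hg.steps, fun s t => (h.presents s t).trans ?_⟩
  exact (simplified_refines (h.rules S.C subset_rfl hT).decreasing hg.steps).conv_iff s t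

theorem LoopInv.iteration [Infinite V] {o : Options} {lr : Bool} (htt : SoundTool ac tt)
    (h : LoopInv tt ac E₀ S) (hS : Iteration tt o ac lr S S') : LoopInv tt ac E₀ S' := by
  obtain ⟨S₁, S₂, S₃, S₄, ρ, ρ', h₁, h₂, h₃, h₄, h₅⟩ := hS
  have i₁ := h.simplifyDelete htt h₁
  have hs := h₂.selected
  have hc₂ := h₂.constraints i₁.finite i₁.isTRS i₁.accepted
  obtain ⟨D, K, hD, hK, rfl⟩ := h₃
  obtain ⟨g, hg, rfl, rfl⟩ := h₄
  have hcol := h₅.collapsed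
  have hB : LinearRegular (AC V ac) := linearRegular_AC ac
  have hC' : S'.C = S₂.C := hcol.constraints
  have hρ' : (ρ.1, g ρ.2) ∈ (composed g (deduced ρ D K S₂)).R := ⟨ρ, Or.inl rfl, rfl⟩
  have chain : ∀ C, S'.C ⊆ C → TerminatingMod (AC V ac) C → StateInv (AC V ac) C S' ∧
      ∀ s t, Conv (S₁.pairs ∪ AC V ac) s t ↔ Conv (S'.pairs ∪ AC V ac) s t := by
    intro C hC hT
    rw [hC'] at hC
    have j₁ := i₁.rules C (hs.constraints.trans hC) hT
    have j₃ := j₁.deduced hB hT hs hC hD hK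
    have j₄ := j₃.composed hB hT hg.steps
    refine ⟨j₄.collapsed hcol hρ', fun s t => ?_⟩
    exact ((deduced_refines (C := C) hs hD.2.1 hK.2.1).conv_iff s t).trans
      (((composed_refines hT j₃.decreasing hg.steps).conv_iff s t).trans
        ((hcol.refines hρ' j₄.decreasing).conv_iff s t))
  have hρ : NF S₁.R ρ.1 := by
    obtain ⟨g₁, hg₁, rfl⟩ := h₁
    rcases hs.origin with hρ | ⟨-, -, -, ⟨⟨d, -, rfl⟩, -⟩ | ⟨⟨d, -, hd⟩, -⟩⟩
    · exact i₁.interreduced.pending ρ hρ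
    · exact (hg₁.nf d.1).mono Set.subset_union_right
    · have : ρ.1 = g₁ d.2 := congrArg Prod.snd hd
      rw [this]
      exact (hg₁.nf d.2).mono Set.subset_union_right
  refine ⟨hC' ▸ hc₂.1, hC' ▸ hc₂.2.1, hC' ▸ hc₂.2.2,
    i₁.interreduced.of_iteration hs hρ hg.nf hcol, fun C hC hT => (chain C hC hT).1,
    fun s t => (i₁.presents s t).trans ?_⟩
  have hT := htt.terminating hc₂.1 hc₂.2.1 hc₂.2.2
  exact (chain S₂.C hC'.subset hT).2 s t

theorem LoopInv.of_thread [Infinite V] {o : Options} {lr : Bool} (htt : SoundTool ac tt)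
    (h : Relation.ReflTransGen (Iteration tt o ac lr) { E := E₀, P := ∅, R := ∅, C := ∅ } S) :
    LoopInv tt ac E₀ S := by
  induction h with
  | refl => exact loopInv_init
  | tail _ h ih => exact ih.iteration htt h

end Loop

end LLAC


theorem mainTheorem11 {L : FirstOrder.Language} {V : Type*} [Infinite V]
    (ac : Set (L.Functions 2)) (tt : Set (LLAC.TPair L V) → Prop) (htt : LLAC.SoundTool ac tt)
    (o : LLAC.Options) (E R : Set (LLAC.TPair L V)) (hE : E.Finite)
    (hR : LLAC.AccompllOutputs tt o ac E R) :
    LLAC.IsTRS R ∧ LLAC.CanonicalMod (LLAC.AC V ac) R ∧ LLAC.PresentsMod (LLAC.AC V ac) R E := by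
  obtain ⟨lr, S₀, S, hrun, hfin, hempty, rfl⟩ := hR
  have inv := (LLAC.LoopInv.of_thread htt hrun).simplifyDelete htt hfin
  have hT := htt.terminating inv.finite inv.isTRS inv.accepted
  have rules := inv.rules S.C subset_rfl hT
  have hSE : S.E = ∅ := (Set.union_empty_iff.1 hempty).1
  have hSP : S.P = ∅ := (Set.union_empty_iff.1 hempty).2
  have hX : S.P ∪ S.R = S.R := by rw [hSP, Set.empty_union]
  have hA : S.pairs = S.R := by rw [LLAC.State.pairs, hX, hSE, Set.empty_union]
  have hdec := rules.decreasing
  have hlin := rules.linear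
  have htrs := rules.isTRS
  have hconn := rules.connected
  rw [hX] at hdec hlin htrs hconn
  rw [hA] at hconn
  have hcomplete : LLAC.CompleteMod (LLAC.AC V ac) S.R :=
    ⟨hdec.terminating hT, hconn.churchRosserMod (LLAC.linearRegular_AC ac) hT hdec hlin⟩
  refine ⟨htrs, ⟨hcomplete, inv.interreduced.left, fun q hq u => ?_⟩, fun s t => ?_⟩
  · exact hcomplete.not_stepMod_of_nf (inv.interreduced.right q hq) u
  · rw [← hA]
    exact inv.presents s t
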